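/- Let $\mathfrak g$ be a finite-dimensional complex simple Lie algebra which is neither of type $A$ nor of type $C$ (so also not $A_1=B_1=C_1$, $B_2=C_2$, $D_3=A_3$). Fix a Cartan subalgebra $\mathfrak t$ and a base of the root system $R$, let $\rho$ be the highest root and write $\langle\alpha\,|\,\beta\rangle$ for the Cartan integer $\langle\alpha,\beta^\vee\rangle$. Let $G$ be the simply connected complex Lie group with Lie algebra $\mathfrak g$, let $0\neq E_\rho\in\mathfrak g_\rho$, and let $Z_{\mathfrak g}=G\cdot[E_\rho]\subset\mathbb P(\mathfrak g)$ be the adjoint variety. Let $o=[E_\rho]$, let $\mathfrak p$ be the Lie algebra of the stabilizer of $o$, so that $T_oZ_{\mathfrak g}=\mathfrak g/\mathfrak p$, and let $D\subset TZ_{\mathfrak g}$ be the contact distribution, i.e. the $G$-invariant subbundle whose fibre at $o$ is $D_o\simeq\bigoplus_{\langle\alpha|\rho\rangle=-1}\mathfrak g_\alpha$. There is no line and no smooth conic in a general direction of $D$: there is a Zariski open subset $U$ of the projectivized bundle $\mathbb P(D)$ which meets every fibre $\mathbb P(D_z)$, $z\in Z_{\mathfrak g}$, such that for every $z\in Z_{\mathfrak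 g}$ and every direction $[w]\in\mathbb P(D_z)\cap U$ there is neither a line nor a smooth conic contained in $Z_{\mathfrak g}$ which passes through $z$ and is tangent to $w$ there. Moreover, $U$ can be chosen to contain the following directions at $o$. Let $\alpha_{j_0}$ be a simple root not orthogonal to $\rho$ and let $m_{j_0}(\alpha)$ be the coefficient of $\alpha_{j_0}$ in a root $\alpha$. There is a long root $\alpha$ with $m_{j_0}(\alpha)=-1$ such that $-\alpha-\rho$ is a root (for some such $\alpha_{j_0}$), and for every such $\alpha_{j_0}$ and $\alpha$ and all nonzero root vectors $E_\alpha\in\mathfrak g_\alpha$, $E_{-\alpha-\rho}\in\mathfrak g_{-\alpha-\rho}$, the vector $v=E_\alpha+E_{-\alpha-\rho}$ lies in $D_o$ and its direction lies in $U$; in particular there is no line and no smooth conic in $Z_{\mathfrak g}$ tangent to $v$ at $o$. -/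

import Mathlib

open LieAlgebra LieAlgebra.IsKilling
open scoped LinearAlgebra.Projectivization

namespace AdjointVariety

section Projective

variable {V : Type*} [AddCommGroup V] [Module ℂ V]

/-- A subset of a finite-dimensional complex vector space is Zariski closed if it is the set of
common zeros of a family of polynomials in the linear coordinates. -/
def IsZariskiClosed (B : Set V) : Prop :=
  ∃ F : Set (MvPolynomial (Module.Dual ℂ V) ℂ),
    B = {x | ∀ f ∈ F, MvPolynomial.eval (fun φ : Module.Dual ℂ V ↦ φ x) f = 0}

/-!
A nonzero vector `x` and a vector `w` represent the tangent vector of the projective space at the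
point `[x]` given by the derivative at `t = 0` of `[x + t w]`, that is, the linear map
`x ↦ w mod ℂ x` in `Hom (ℂ x, V / ℂ x)`. It is nonzero iff `w` is not a multiple of `x`, and in
this case the pair `(x, w)` represents a point of the projectivized tangent space at `[x]`.
-/

/-- The pair `(x, w)` is tangent at `[x]` to a (projective) line which is contained in `Z`. -/
def TangentToLine (Z : Set (ℙ ℂ V)) (x w : V) : Prop :=
  ∃ W : Submodule ℂ V, Module.finrank ℂ W = 2 ∧
    (∀ z : ℙ ℂ V, z.submodule ≤ W → z ∈ Z) ∧ x ∈ W ∧ w ∈ W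

variable (V) in
/-- A smooth conic in the projective space of `V`: a plane together with a nondegenerate ternary
quadratic form on it (up to scaling, the equation of the conic). -/
structure SmoothConic where
  /-- the linear span of the conic -/
  plane : Submodule ℂ V
  finrank_plane : Module.finrank ℂ plane = 3
  /-- the equation of the conic -/
  form : QuadraticForm ℂ plane
  nondegenerate : (QuadraticMap.polarBilin form).Nondegenerate

/-- The points of a smooth conic. -/
def SmoothConic.points (C : SmoothConic V) : Set (ℙ ℂ V) :=
  {z | ∃ x : C.plane, C.form x = 0 ∧ z.submodule = Submodule.span ℂ {(x : V)}}

/-- The point `[x]` lies on the conic and the pair `(x, w)` is tangent to the conic at `[x]`, i.e.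
`w` lies in the plane and the derivative at `x` of the equation vanishes on `w`. -/
def SmoothConic.Tangent (C : SmoothConic V) (x w : V) : Prop :=
  ∃ x' w' : C.plane, (x' : V) = x ∧ (w' : V) = w ∧
    C.form x' = 0 ∧ QuadraticMap.polar C.form x' w' = 0

/-- The pair `(x, w)` is tangent at `[x]` to a smooth conic which is contained in `Z`. -/
def TangentToSmoothConic (Z : Set (ℙ ℂ V)) (x w : V) : Prop :=
  ∃ C : SmoothConic V, C.points ⊆ Z ∧ C.Tangent x w

end Projective

section Lie

variable (L : Type*) [LieRing L] [LieAlgebra ℂ L]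

/-- `g = exp (ad X)`, the sum of the exponential series being taken coordinatewise. -/
def IsExpAd (X : L) (g : L ≃ₗ⁅ℂ⁆ L) : Prop :=
  ∀ (y : L) (φ : Module.Dual ℂ L),
    HasSum (fun k : ℕ ↦ (k.factorial : ℂ)⁻¹ * φ (((LieAlgebra.ad ℂ L X) ^ k) y)) (φ (g y))

/-- Membership in the adjoint group of `L`, i.e. in the image in `Aut L` under `Ad` of a connected
complex Lie group with Lie algebra `L`: the subgroup of `Aut L` generated by the automorphisms
`exp (ad X)`, `X ∈ L`. -/
inductive InAdjointGroup : (L ≃ₗ⁅ℂ⁆ L) → Prop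
  | exp_ad (X : L) (g : L ≃ₗ⁅ℂ⁆ L) (hg : IsExpAd L X g) : InAdjointGroup g
  | refl : InAdjointGroup LieEquiv.refl
  | symm (g : L ≃ₗ⁅ℂ⁆ L) (hg : InAdjointGroup g) : InAdjointGroup g.symm
  | trans (g h : L ≃ₗ⁅ℂ⁆ L) (hg : InAdjointGroup g) (hh : InAdjointGroup h) :
      InAdjointGroup (g.trans h)

variable {L}
variable [FiniteDimensional ℂ L] [LieAlgebra.IsSimple ℂ L]
variable {H : LieSubalgebra ℂ L} [H.IsCartanSubalgebra]

/-- `L` is of type `A`, in terms of the Cartan matrix of a base of its root system. -/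
def IsTypeA (b : (rootSystem H).Base) : Prop :=
  ∃ (n : ℕ) (e : b.support ≃ Fin n), Matrix.reindex e e b.cartanMatrix = CartanMatrix.A n

/-- `L` is of type `C` (this includes the types `C₁ = A₁` and `C₂ = B₂`), in terms of the Cartan
matrix of a base of its root system. -/
def IsTypeC (b : (rootSystem H).Base) : Prop :=
  ∃ (n : ℕ) (e : b.support ≃ Fin n), Matrix.reindex e e b.cartanMatrix = CartanMatrix.C n

/-- `ρ` is the highest root with respect to `b`: for every root `α`, the difference `ρ - α` is a
sum of simple roots. -/
def IsHighestRoot (b : (rootSystem H).Base) (ρ : H.root) : Prop :=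
  ∀ α : H.root, (rootSystem H).root ρ - (rootSystem H).root α ∈
    AddSubmonoid.closure ((rootSystem H).root '' b.support)

/-- `α` is a long root: a root of maximal length for the Weyl-invariant inner product. -/
def IsLongRoot (α : H.root) : Prop :=
  ∀ β : H.root, ((rootSystem H).posRootForm ℤ).rootLength β ≤
    ((rootSystem H).posRootForm ℤ).rootLength α

/-- The coefficient of the simple root `j` in the root `α`. -/
noncomputable def simpleCoeff (b : (rootSystem H).Base) (j : b.support) (α : H.root) : ℂ :=
  b.toWeightBasis.repr ((rootSystem H).root α) j

/-- The adjoint variety: the orbit of the point `o = [E_ρ]`, i.e. of the line `𝔤_ρ`, under the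
adjoint action. -/
def adjointVariety (ρ : H.root) : Set (ℙ ℂ L) :=
  {z | ∃ g : L ≃ₗ⁅ℂ⁆ L, InAdjointGroup L g ∧
    z.submodule = (rootSpace H ρ.1).toSubmodule.map ((g : L →ₗ⁅ℂ⁆ L) : L →ₗ[ℂ] L)}

/-- The sum of the root spaces `𝔤_α` over the roots `α` with `⟨α | ρ⟩ = -1`. By `v ↦ v mod 𝔭` it
is identified with the fibre `D_o` in `T_o Z = 𝔤 / 𝔭` of the contact distribution at `o`. -/
noncomputable def contactFiber (ρ : H.root) : Submodule ℂ L :=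
  ⨆ (α : H.root) (_ : (rootSystem H).pairing α ρ = -1), (rootSpace H α.1).toSubmodule

/-- The pairs `(x, w)` which represent the nonzero vectors of the contact distribution `D`. The
class of `v` in `T_o Z = 𝔤 / 𝔭` is the derivative at `t = 0` of `exp (t v) [e]`, `0 ≠ e ∈ 𝔤_ρ`, so
it is represented by the pair `(e, ⁅v, e⁆)`, and `D` is the translate of `D_o` by the adjoint
action. -/
def contactDirections (ρ : H.root) : Set (L × L) :=
  {p | ∃ g : L ≃ₗ⁅ℂ⁆ L, InAdjointGroup L g ∧
    ∃ e ∈ rootSpace H ρ.1, ∃ v ∈ contactFiber ρ, ∃ c : ℂ,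
    p.1 = g e ∧ p.2 = g ⁅v, e⁆ + c • g e ∧ p.1 ≠ 0 ∧ p.2 ∉ Submodule.span ℂ {p.1}}

end Lie

end AdjointVariety

/-! The open set is the locus where the direction `w`, as an element of the Lie algebra, satisfies
`(ad w) ^ 4 ≠ 0`. Two facts are needed.

A contact direction `w` tangent to a line or smooth conic has `(ad w) ^ 4 = 0`. Every point `x` of
the cone over the adjoint variety satisfies `⁅x, ⁅x, y⁆⁆ = c κ(x, y) x` (`exists_lie_lie_eq`), with
`κ` the Killing form, and a tangent line or conic contains a curve `e + s w + s² u`. The coroot of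
`ρ` grades the algebra in degrees `-2, ..., 2`, with `e ∈ 𝔤_ρ` in degree `2`, `f ∈ 𝔤_{-ρ}` spanning
degree `-2`, and `w` in degree `1` modulo `e`. Inserting the curve with `y = f` and comparing powers
of `s` and degrees forces `(ad w)³ f = 0` (`lie_lie_lie_eq_zero`). By degrees, `(ad w)⁴` can be
nonzero only on degree `-2`, so it vanishes (`ad_pow_four_eq_zero`).

Conversely, if `α` is long and `α + β + ρ = 0`, the three roots span an `A₂`, and a computation
there gives `(ad w)⁴ f ≠ 0` for `w = ⁅E_α + E_β, e⁆` (`lie_pow_four_ne_zero_of_isSl2Triple`). Such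
an `α` comes from a long root with Cartan integer `1` against `ρ`. If there were none, `ρ` would be
orthogonal to all long roots except `±ρ`, and descending from `ρ` through simple reflections would
reconstruct the Cartan matrix of type `C` (`exists_reindex_cartanMatrix_eq_C`). -/

set_option linter.unusedSectionVars false

/-! ### Highest roots and long roots. -/

namespace RootPairing.Base

variable {ι R M N : Type*} [Fintype ι] [Field R] [CharZero R] [AddCommGroup M] [Module R M]
  [AddCommGroup N] [Module R N] {P : RootPairing ι R M N} [P.IsRootSystem] [P.IsCrystallographic]
  [P.IsReduced] (b : P.Base)

lemma repr_eq_natCast_of_mem_closure {x : M} (hx : x ∈ AddSubmonoid.closure (P.root '' b.support))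
    (j : b.support) : ∃ n : ℕ, b.toWeightBasis.repr x j = n := by
  classical
  induction hx using AddSubmonoid.closure_induction with
  | mem x hx =>
    obtain ⟨i, hi, rfl⟩ := hx
    refine ⟨if (⟨i, hi⟩ : b.support) = j then 1 else 0, ?_⟩
    rw [b.toWeightBasis_repr_root ⟨i, hi⟩, Finsupp.single_apply]
    split_ifs <;> simp
  | zero => exact ⟨0, by simp⟩
  | add x y _ _ hx hy =>
    obtain ⟨m, hm⟩ := hx
    obtain ⟨n, hn⟩ := hy
    exact ⟨m + n, by simp [hm, hn]⟩

lemma eq_zero_of_mem_closure_of_neg_mem_closure {x : M}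
    (hx : x ∈ AddSubmonoid.closure (P.root '' b.support))
    (hx' : -x ∈ AddSubmonoid.closure (P.root '' b.support)) : x = 0 := by
  refine b.toWeightBasis.ext_elem fun j ↦ ?_
  obtain ⟨m, hm⟩ := b.repr_eq_natCast_of_mem_closure hx j
  obtain ⟨n, hn⟩ := b.repr_eq_natCast_of_mem_closure hx' j
  have h : ((n + m : ℕ) : R) = 0 := by
    push_cast
    rw [← hn, ← hm]
    simp
  have hm0 : m = 0 := by
    have := Nat.cast_eq_zero.mp h
    omega
  simp [hm, hm0]

/-- `ρ` is the highest root: `ρ - α` is a sum of simple roots for every root `α`. -/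
def IsHighest (ρ : ι) : Prop :=
  ∀ i, P.root ρ - P.root i ∈ AddSubmonoid.closure (P.root '' b.support)

/-- A root of maximal length. -/
def _root_.RootPairing.IsLong (P : RootPairing ι R M N) [P.IsCrystallographic] (i : ι) : Prop :=
  ∀ j, (P.posRootForm ℤ).rootLength j ≤ (P.posRootForm ℤ).rootLength i

variable {b}

omit [P.IsRootSystem] [P.IsReduced] in
lemma _root_.RootPairing.rootLength_reflectionPerm (i j : ι) :
    (P.posRootForm ℤ).rootLength (P.reflectionPerm i j) = (P.posRootForm ℤ).rootLength j := by
  apply FaithfulSMul.algebraMap_injective ℤ R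
  rw [RootPositiveForm.algebraMap_rootLength, RootPositiveForm.algebraMap_rootLength,
    root_reflectionPerm]
  exact (P.posRootForm ℤ).isOrthogonal_reflection i _ _

omit [P.IsRootSystem] [P.IsReduced] in
lemma _root_.RootPairing.IsLong.reflectionPerm {i : ι} (hi : P.IsLong i) (j : ι) :
    P.IsLong (P.reflectionPerm j i) := fun k ↦ by
  rw [rootLength_reflectionPerm]
  exact hi k

omit [P.IsRootSystem] [P.IsReduced] in
lemma _root_.RootPairing.IsLong.pairingIn_mem {i j : ι} (hi : P.IsLong i)
    (h : P.root j ≠ P.root i) (h' : P.root j ≠ -P.root i) :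
    P.pairingIn ℤ j i ∈ ({-1, 0, 1} : Set ℤ) := by
  by_contra hc
  exact (hi j).not_gt ((P.posRootForm ℤ).rootLength_lt_of_pairingIn_notMem h h' hc)

omit [Fintype ι] [CharZero R] [P.IsRootSystem] [P.IsCrystallographic] [P.IsReduced] in
lemma exists_root_eq_neg (P : RootPairing ι R M N) (i : ι) : ∃ k, P.root k = -P.root i :=
  ⟨P.reflectionPerm i i, by simp⟩

namespace IsHighest

variable {ρ : ι} (hρ : b.IsHighest ρ)
include hρ

lemma mem_closure : P.root ρ ∈ AddSubmonoid.closure (P.root '' b.support) := by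
  refine (b.root_mem_or_neg_mem ρ).resolve_right fun h ↦ ?_
  obtain ⟨k, hk⟩ := exists_root_eq_neg P ρ
  have h1 := hρ k
  rw [hk] at h1
  have h2 := b.eq_zero_of_mem_closure_of_neg_mem_closure h1
    (by convert add_mem h h using 1; abel)
  have h3 : (2 : R) • P.root ρ = 0 := by rw [two_smul]; simpa using h2
  exact P.ne_zero ρ ((smul_eq_zero.mp h3).resolve_left two_ne_zero)

/-- If the Cartan integer is `-(m + 2)`, then `i + (m + 2)ρ` is a root, so `-(i + (m + 1)ρ)` is a
sum of simple roots. So is `(ρ + i) + mρ`, because `-i` is a root. Hence `i = -(m + 1)ρ`, and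
pairing with `ρ` leaves only `m = 0`. -/
lemma neg_one_le_pairingIn {i : ι} (hi : P.root i ≠ -P.root ρ) : -1 ≤ P.pairingIn ℤ i ρ := by
  by_contra! hlt
  obtain ⟨m, hm⟩ : ∃ m : ℕ, P.pairingIn ℤ i ρ = -(m + 2) :=
    ⟨(-2 - P.pairingIn ℤ i ρ).toNat, by omega⟩
  have h1 := hρ (P.reflectionPerm ρ i)
  rw [root_reflectionPerm, reflection_apply_root' ℤ, hm] at h1
  obtain ⟨k, hk⟩ := exists_root_eq_neg P i
  have h2 := add_mem (hρ k) (nsmul_mem hρ.mem_closure m)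
  rw [hk] at h2
  have h3 := b.eq_zero_of_mem_closure_of_neg_mem_closure h2 (by convert h1 using 1; module)
  have h4 : P.root i = (-(m + 1 : ℤ)) • P.root ρ := by
    rw [← sub_eq_zero, ← h3]
    module
  have h5 : P.pairingIn ℤ i ρ = -(m + 1) * 2 := by
    apply FaithfulSMul.algebraMap_injective ℤ R
    rw [algebraMap_pairingIn, ← root_coroot_eq_pairing, h4, map_zsmul, LinearMap.smul_apply,
      root_coroot_two]
    simp
  have hm0 : m = 0 := by omega
  subst hm0
  exact hi (by simpa using h4)

lemma pairingIn_mem {i : ι} (hi : P.root i ≠ P.root ρ) (hi' : P.root i ≠ -P.root ρ) :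
    P.pairingIn ℤ i ρ ∈ ({-1, 0, 1} : Set ℤ) := by
  have h1 := hρ.neg_one_le_pairingIn hi'
  have h2 := hρ.neg_one_le_pairingIn (i := P.reflectionPerm i i) (by simpa using hi)
  rw [pairingIn_reflectionPerm_self_left] at h2
  simp only [Set.mem_insert_iff, Set.mem_singleton_iff]
  omega

lemma pairingIn_simple_nonneg {j : ι} (hj : j ∈ b.support) : 0 ≤ P.pairingIn ℤ j ρ := by
  have hjc : P.root j ∈ AddSubmonoid.closure (P.root '' b.support) :=
    AddSubmonoid.subset_closure ⟨j, hj, rfl⟩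
  by_contra! hlt
  by_cases h : P.root j = -P.root ρ
  · exact P.ne_zero ρ
      (b.eq_zero_of_mem_closure_of_neg_mem_closure hρ.mem_closure (h ▸ hjc))
  · obtain ⟨k, hk⟩ := P.root_add_root_mem_of_pairingIn_neg hlt h
    have h1 := hρ k
    rw [hk] at h1
    exact P.ne_zero j (b.eq_zero_of_mem_closure_of_neg_mem_closure hjc (by simpa using h1))

lemma repr_ne_zero (j : b.support) : b.toWeightBasis.repr (P.root ρ) j ≠ 0 := by
  obtain ⟨n, hn⟩ := b.repr_eq_natCast_of_mem_closure (hρ j) j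
  rw [map_sub, Finsupp.sub_apply, b.toWeightBasis_repr_root, Finsupp.single_eq_same,
    sub_eq_iff_eq_add] at hn
  rw [hn]
  exact_mod_cast n.succ_ne_zero

/-- A long root `l` of maximal height is dominant, since reflecting in a simple root with negative
pairing would raise the height. Dominance against `ρ - l` gives `⟨ρ, l⟩ ≥ 2`, so `⟨l, ρ⟩ ≠ 0`;
unless `l = ±ρ` it is `±1`, which forces `l` to be no longer than `ρ`. -/
lemma isLong : P.IsLong ρ := by
  have : Nonempty ι := ⟨ρ⟩
  obtain ⟨i₀, hi₀⟩ := Finite.exists_max fun i ↦ (P.posRootForm ℤ).rootLength i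
  have : Nonempty {i // P.IsLong i} := ⟨⟨i₀, hi₀⟩⟩
  obtain ⟨⟨l, hl⟩, hmax⟩ := Finite.exists_max fun i : {i // P.IsLong i} ↦ b.height i
  have hdom (j : ι) (hj : j ∈ b.support) : 0 ≤ P.pairingIn ℤ j l := by
    by_contra! hlt
    rw [P.pairingIn_lt_zero_iff] at hlt
    have h1 := hmax ⟨_, hl.reflectionPerm j⟩
    have h2 : P.root (P.reflectionPerm j l) = P.root l + (-P.pairingIn ℤ l j) • P.root j := by
      rw [root_reflectionPerm, neg_smul, reflection_apply_root' ℤ, sub_eq_add_neg]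
    rw [b.height_add_zsmul h2, height_one_of_mem_support hj] at h1
    simp only [smul_eq_mul] at h1
    omega
  have hnonneg {x : M} (hx : x ∈ AddSubmonoid.closure (P.root '' b.support)) :
      ∃ n : ℕ, P.toLinearMap x (P.coroot l) = n := by
    induction hx using AddSubmonoid.closure_induction with
    | mem x hx =>
      obtain ⟨j, hj, rfl⟩ := hx
      obtain ⟨n, hn⟩ := Int.eq_ofNat_of_zero_le (hdom j hj)
      exact ⟨n, by simp [← P.algebraMap_pairingIn ℤ, hn]⟩
    | zero => exact ⟨0, by simp⟩
    | add x y _ _ hx hy =>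
      obtain ⟨m, hm⟩ := hx
      obtain ⟨n, hn⟩ := hy
      exact ⟨m + n, by simp [hm, hn]⟩
  obtain ⟨n, hn⟩ := hnonneg (hρ l)
  have h2 : P.pairingIn ℤ ρ l = n + 2 := by
    apply FaithfulSMul.algebraMap_injective ℤ R
    rw [map_sub, LinearMap.sub_apply, root_coroot_two, root_coroot_eq_pairing,
      sub_eq_iff_eq_add] at hn
    rw [algebraMap_pairingIn, hn]
    simp
  by_cases h : P.root l = P.root ρ
  · exact P.root.injective h ▸ hl
  by_cases h' : P.root l = -P.root ρ
  · have hlρ : l = P.reflectionPerm ρ ρ := P.root.injective (by simpa using h')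
    intro k
    have := hl k
    rwa [hlρ, RootPositiveForm.rootLength_reflectionPerm_self] at this
  have h3 : P.pairingIn ℤ l ρ ≠ 0 := fun h0 ↦ by
    rw [P.pairingIn_eq_zero_iff] at h0
    omega
  have h4 := hρ.pairingIn_mem h h'
  exact fun k ↦ (hl k).trans <|
    (P.posRootForm ℤ).rootLength_le_of_pairingIn_eq (by simp_all)

/-- If a long root `δ` satisfies `⟨δ, ρ⟩ = 1`, then it has coefficient one at a simple root which
is not orthogonal to `ρ`. -/
lemma exists_simple_repr_eq_one {δ : ι} (hδ : P.pairingIn ℤ δ ρ = 1) :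
    ∃ j : b.support, P.pairing j ρ ≠ 0 ∧ b.toWeightBasis.repr (P.root δ) j = 1 := by
  classical
  obtain ⟨f, -, hf, hsum⟩ := b.exists_root_eq_sum_int δ
  -- All terms of this sum are nonnegative integers, so a nonzero one equals `1`, and both of its
  -- factors are `1`.
  have h1 : 1 = ∑ j ∈ b.support, f j * P.pairingIn ℤ j ρ := by
    rw [← hδ]
    apply FaithfulSMul.algebraMap_injective ℤ R
    rw [algebraMap_pairingIn, ← root_coroot_eq_pairing, hsum]
    simp [← P.algebraMap_pairingIn ℤ]
  have hf' : 0 < f := by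
    refine hf.resolve_right fun h ↦ ?_
    have := Finset.sum_nonpos fun j (hj : j ∈ b.support) ↦
      mul_nonpos_of_nonpos_of_nonneg (h.le j) (hρ.pairingIn_simple_nonneg hj)
    omega
  have hnn : ∀ j ∈ b.support, 0 ≤ f j * P.pairingIn ℤ j ρ := fun j hj ↦
    mul_nonneg (hf'.le j) (hρ.pairingIn_simple_nonneg hj)
  obtain ⟨j, hj, hj0⟩ := Finset.exists_ne_zero_of_sum_ne_zero (h1 ▸ one_ne_zero)
  have hle : f j * P.pairingIn ℤ j ρ ≤ 1 := h1 ▸ Finset.single_le_sum hnn hj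
  have h1j : f j * P.pairingIn ℤ j ρ = 1 := by
    have := hnn j hj
    omega
  refine ⟨⟨j, hj⟩, ?_, ?_⟩
  · rw [← P.algebraMap_pairingIn ℤ]
    simpa using right_ne_zero_of_mul hj0
  · have hfj : f j = 1 := by
      rcases Int.eq_one_or_neg_one_of_mul_eq_one h1j with h | h
      · exact h
      · have : 0 ≤ f j := hf'.le j
        omega
    rw [hsum, map_sum, Finsupp.finsetSum_apply, Finset.sum_eq_single_of_mem j hj]
    · rw [map_zsmul, Finsupp.smul_apply, b.toWeightBasis_repr_root ⟨j, hj⟩]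
      simp [hfj]
    · intro k hk hkj
      rw [map_zsmul, Finsupp.smul_apply, b.toWeightBasis_repr_root ⟨k, hk⟩,
        Finsupp.single_eq_of_ne]
      · simp
      · simpa using hkj.symm

end IsHighest

end RootPairing.Base

/-! ### Isolated long roots and type `C`. -/

namespace RootPairing.Base

variable {ι R M N : Type*} [Fintype ι] [Field R] [CharZero R] [AddCommGroup M] [Module R M]
  [AddCommGroup N] [Module R N] {P : RootPairing ι R M N} [P.IsRootSystem] [P.IsCrystallographic]
  [P.IsReduced] {b : P.Base}

/-- A long root which is orthogonal to every long root except itself and its negative. -/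
def _root_.RootPairing.IsIsolatedLong (P : RootPairing ι R M N) [P.IsCrystallographic] (i : ι) :
    Prop :=
  P.IsLong i ∧
    ∀ j, P.IsLong j → P.root j = P.root i ∨ P.root j = -P.root i ∨ P.pairingIn ℤ j i = 0

lemma _root_.RootPairing.IsIsolatedLong.reflectionPerm {i : ι} (hi : P.IsIsolatedLong i) (j : ι) :
    P.IsIsolatedLong (P.reflectionPerm j i) := by
  refine ⟨hi.1.reflectionPerm j, fun k hk ↦ ?_⟩
  have h : P.root k = P.reflection j (P.root (P.reflectionPerm j k)) := by simp
  have h' : P.pairingIn ℤ k (P.reflectionPerm j i) = P.pairingIn ℤ (P.reflectionPerm j k) i := by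
    apply FaithfulSMul.algebraMap_injective ℤ R
    rw [algebraMap_pairingIn, algebraMap_pairingIn, pairing_reflectionPerm]
  rw [h']
  rcases hi.2 _ (hk.reflectionPerm j) with h1 | h1 | h1
  · exact .inl (by rw [h, h1, root_reflectionPerm])
  · exact .inr (.inl (by rw [h, h1, root_reflectionPerm, map_neg]))
  · exact .inr (.inr h1)

/-- Subtracting simple roots twice, one descends from a positive isolated long root to a simple
one, through isolated long roots. -/
lemma exists_chain {l : ι} (hl : P.IsIsolatedLong l) (hpos : b.IsPos l) :
    ∃ (n : ℕ) (r a : ℕ → ι), r 0 = l ∧ (∀ i ≤ n, P.IsIsolatedLong (r i)) ∧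
      (∀ i ≤ n, b.IsPos (r i)) ∧ (∀ i ≤ n, a i ∈ b.support) ∧ r n = a n ∧
      (∀ i < n, P.root (r i) = P.root (r (i + 1)) + (2 : ℤ) • P.root (a i)) ∧
      (∀ i < n, P.pairingIn ℤ (r i) (a i) = 2) ∧
      (∀ φ : M →+ R, (∀ i ≤ n, φ (P.root (a i)) = 0) → φ (P.root l) = 0) := by
  generalize hN : (b.height l).toNat = N
  induction N using Nat.strongRecOn generalizing l with
  | ind N ih =>
  obtain ⟨j, hj, hjl⟩ := hpos.exists_mem_support_pos_pairingIn
  by_cases hlj : l = j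
  · subst hlj
    exact ⟨0, fun _ ↦ l, fun _ ↦ l, rfl, fun _ _ ↦ hl, fun _ _ ↦ hpos, fun _ _ ↦ hj, rfl,
      by simp, by simp, fun φ h ↦ h 0 le_rfl⟩
  have hroot := P.reflection_apply_root' ℤ (i := j) (j := l)
  rw [← root_reflectionPerm] at hroot
  have hpos' := hpos.reflectionPerm hj hlj
  have hl' := hl.reflectionPerm j
  generalize P.reflectionPerm j l = l' at hroot hpos' hl'
  have hlj' : 0 < P.pairingIn ℤ l j := by rwa [zero_lt_pairingIn_iff']
  have hjmem : P.pairingIn ℤ j l ∈ ({-1, 0, 1} : Set ℤ) := by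
    refine hl.1.pairingIn_mem (fun h ↦ hlj (P.root.injective h.symm)) fun h ↦ ?_
    have : P.pairingIn ℤ j l = -2 := by
      apply FaithfulSMul.algebraMap_injective ℤ R
      rw [algebraMap_pairingIn, ← root_coroot_eq_pairing, h]
      simp
    omega
  have hj1 : P.pairingIn ℤ j l = 1 := by
    simp only [Set.mem_insert_iff, Set.mem_singleton_iff] at hjmem
    omega
  have hpair : P.pairingIn ℤ l' l = 2 - P.pairingIn ℤ l j := by
    apply FaithfulSMul.algebraMap_injective ℤ R
    rw [algebraMap_pairingIn, ← root_coroot_eq_pairing, hroot, map_sub, map_zsmul,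
      LinearMap.sub_apply, LinearMap.smul_apply, root_coroot_two, root_coroot_eq_pairing,
      ← P.algebraMap_pairingIn ℤ j l, hj1]
    simp
  -- The reflected root `l'` is again long and differs from `±l`, so isolation makes it orthogonal
  -- to `l`; its pairing with `l` is `2 - ⟨l, j⟩`.
  have h2 : P.pairingIn ℤ l j = 2 := by
    rcases hl.2 l' hl'.1 with h | h | h
    · rw [h, eq_comm, sub_eq_self, ← Int.cast_smul_eq_zsmul R, smul_eq_zero] at hroot
      rcases hroot with h0 | h0
      · have : P.pairingIn ℤ l j = 0 := by exact_mod_cast h0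
        omega
      · exact (P.ne_zero j h0).elim
    · have : l' = P.reflectionPerm l l := P.root.injective (by simpa using h)
      have h3 := b.height_reflectionPerm_self l
      rw [indexNeg_neg, ← this] at h3
      rw [isPos_iff] at hpos hpos'
      omega
    · omega
  rw [h2] at hroot
  have hheight : b.height l' = b.height l - 2 := by
    have : P.root l' = P.root l + (-2 : ℤ) • P.root j := by rw [hroot]; module
    rw [b.height_add_zsmul this, height_one_of_mem_support hj]
    simp [sub_eq_add_neg]
  rw [isPos_iff] at hpos'
  obtain ⟨n, r, a, hr0, hiso, hp, ha, hn, hstep, h2', hφ⟩ := ih _ (by omega) hl' hpos' rfl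
  refine ⟨n + 1, fun i ↦ i.casesOn l r, fun i ↦ i.casesOn j a, rfl, ?_, ?_, ?_, hn, ?_, ?_, ?_⟩
  · rintro (_ | i) hi
    · exact hl
    · exact hiso i (by omega)
  · rintro (_ | i) hi
    · exact hpos
    · exact hp i (by omega)
  · rintro (_ | i) hi
    · exact hj
    · exact ha i (by omega)
  · rintro (_ | i) hi
    · simp only [hr0, hroot]
      module
    · exact hstep i (by omega)
  · rintro (_ | i) hi
    · exact h2
    · exact h2' i (by omega)
  · intro φ h
    have h0 : φ (P.root j) = 0 := h 0 (by omega)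
    have h1 := hφ φ fun i hi ↦ h (i + 1) (by omega)
    rw [hroot, map_sub, map_zsmul] at h1
    simpa [h0] using h1

variable {ρ : ι}

/-- If no long root has Cartan integer one with the highest root, the Cartan matrix is of
type `C`. -/
theorem IsHighest.exists_reindex_cartanMatrix_eq_C (hρ : b.IsHighest ρ)
    (h : ∀ i, P.IsLong i → P.pairingIn ℤ i ρ ≠ 1) :
    ∃ (n : ℕ) (e : b.support ≃ Fin n), Matrix.reindex e e b.cartanMatrix = CartanMatrix.C n := by
  -- A long root other than `±ρ` pairs with `ρ` to `-1`, `0` or `1`; passing to its negative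
  -- excludes `-1` along with `1`.
  have hiso : P.IsIsolatedLong ρ := by
    refine ⟨hρ.isLong, fun i hi ↦ ?_⟩
    by_contra! hc
    have h1 := hρ.pairingIn_mem hc.1 hc.2.1
    have h2 := h _ hi
    have h3 := h _ (hi.reflectionPerm i)
    rw [pairingIn_reflectionPerm_self_left] at h3
    simp only [Set.mem_insert_iff, Set.mem_singleton_iff] at h1
    have := hc.2.2
    omega
  have hpos : b.IsPos ρ := by
    refine (IsPos.or_neg b ρ).resolve_right fun hneg ↦ ?_
    obtain ⟨j, hj, hj'⟩ := hneg.exists_mem_support_pos_pairingIn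
    rw [indexNeg_neg, pairingIn_reflectionPerm_self_right] at hj'
    have := hρ.pairingIn_simple_nonneg hj
    omega
  obtain ⟨n, r, a, hr0, hiso, hp, ha, hn, hstep, h2, hφ⟩ := exists_chain hiso hpos
  have hanti {i j : ℕ} (hij : i < j) (hj : j ≤ n) : b.height (r j) < b.height (r i) := by
    induction j, hij using Nat.le_induction with
    | base =>
      rw [b.height_add_zsmul (hstep i (by omega)), height_one_of_mem_support (ha i (by omega))]
      simp
    | succ j hij ih =>
      refine lt_trans ?_ (ih (by omega))
      rw [b.height_add_zsmul (hstep j (by omega)), height_one_of_mem_support (ha j (by omega))]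
      simp
  -- The model is `r i = 2 ε_i` and `a i = ε_i - ε_{i+1}`, with `a n = r n`. Strictly decreasing
  -- heights separate the `r i`, positivity excludes opposite ones, and isolation then makes them
  -- orthogonal.
  have horth {i j : ℕ} (hi : i ≤ n) (hj : j ≤ n) :
      P.pairingIn ℤ (r i) (r j) = if i = j then 2 else 0 := by
    split_ifs with hij
    · subst hij
      simp
    have hne : b.height (r i) ≠ b.height (r j) := by
      rcases lt_or_gt_of_ne hij with h | h
      · exact (hanti h hj).ne'
      · exact (hanti h hi).ne
    rcases (hiso j hj).2 (r i) (hiso i hi).1 with h | h | h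
    · exact (hne (by rw [P.root.injective h])).elim
    · have h3 := b.height_reflectionPerm_self (r j)
      rw [indexNeg_neg, ← show r i = P.reflectionPerm (r j) (r j) from
        P.root.injective (by simpa using h)] at h3
      have h4 := hp i hi
      have h5 := hp j hj
      rw [isPos_iff] at h4 h5
      omega
    · exact h
  have hpair {i : ℕ} (hi : i < n) (k : ι) :
      P.pairingIn ℤ (r i) k = P.pairingIn ℤ (r (i + 1)) k + 2 * P.pairingIn ℤ (a i) k := by
    apply FaithfulSMul.algebraMap_injective ℤ R
    rw [algebraMap_pairingIn, ← root_coroot_eq_pairing, hstep i hi]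
    simp [← P.algebraMap_pairingIn ℤ]
  have har {i j : ℕ} (hi : i < n) (hj : j ≤ n) :
      P.pairingIn ℤ (a i) (r j) = (if i = j then 1 else 0) - if i + 1 = j then 1 else 0 := by
    have h1 := hpair hi (r j)
    rw [horth hi.le hj, horth hi hj] at h1
    split_ifs at h1 ⊢ <;> omega
  have hra {i j : ℕ} (hi : i ≤ n) (hj : j < n) :
      P.pairingIn ℤ (r i) (a j) = (if i = j then 2 else 0) - if i = j + 1 then 2 else 0 := by
    by_cases hij : i = j
    · subst hij
      simp [h2 i hj]
    by_cases hij' : i = j + 1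
    · subst hij'
      have h1 := hpair hj (a j)
      rw [h2 j hj] at h1
      simp at h1 ⊢
      omega
    have h1 := har hj hi
    rw [if_neg (Ne.symm hij), if_neg (Ne.symm hij'), sub_zero, P.pairingIn_eq_zero_iff] at h1
    simp [h1, hij, hij']
  have hinj {i j : ℕ} (hij : i < j) (hj : j ≤ n) : a i ≠ a j := fun h ↦ by
    have h1 := har (hij.trans_le hj) (hij.le.trans hj)
    rw [h] at h1
    rcases hj.lt_or_eq with hj | rfl
    · rw [har hj (by omega)] at h1
      split_ifs at h1 <;> omega
    · rw [← hn, horth le_rfl (by omega)] at h1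
      split_ifs at h1 <;> omega
  let f : Fin (n + 1) → b.support := fun i ↦ ⟨a i, ha i (by omega)⟩
  have hf : Function.Bijective f := by
    refine ⟨fun i j hij ↦ ?_, fun j ↦ ?_⟩
    · by_contra hne
      rcases lt_or_gt_of_ne hne with h | h
      · exact hinj h (by omega) (congrArg Subtype.val hij)
      · exact hinj h (by omega) (congrArg Subtype.val hij.symm)
    -- The coordinate functional of a simple root missing from the chain would kill `ρ`, whose
    -- coordinates are all nonzero.
    · by_contra! hj
      refine hρ.repr_ne_zero j ?_
      refine hφ ((b.toWeightBasis.coord j).toAddMonoidHom) fun i hi ↦ ?_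
      have := b.toWeightBasis_repr_root (f ⟨i, by omega⟩)
      simp only [f] at this
      simp only [LinearMap.toAddMonoidHom_coe, Module.Basis.coord_apply, this]
      exact Finsupp.single_eq_of_ne (hj ⟨i, by omega⟩).symm
  refine ⟨n + 1, (Equiv.ofBijective f hf).symm, ?_⟩
  ext ⟨i, hi⟩ ⟨j, hj⟩
  simp only [Matrix.reindex_apply, Equiv.symm_symm, Matrix.submatrix_apply,
    Equiv.ofBijective_apply, cartanMatrix, cartanMatrixIn_def, f, CartanMatrix.C, Matrix.of_apply,
    Fin.mk.injEq, Nat.add_sub_cancel]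
  -- Away from the last row and column, `2 a_i = r_i - r_{i+1}` gives twice each entry; in the last
  -- ones `a n` is replaced by `r n`.
  rcases (Nat.lt_succ_iff.mp hi).lt_or_eq with hi' | rfl
  · rcases (Nat.lt_succ_iff.mp hj).lt_or_eq with hj' | rfl
    · have h1 := hpair hi' (a j)
      rw [hra hi'.le hj', hra hi' hj'] at h1
      split_ifs at h1 ⊢ <;> omega
    · rw [← hn, har hi' le_rfl]
      split_ifs <;> omega
  · rw [← hn]
    rcases (Nat.lt_succ_iff.mp hj).lt_or_eq with hj' | rfl
    · rw [hra le_rfl hj']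
      split_ifs <;> omega
    · rw [hn]
      simp

end RootPairing.Base

/-! ### Five-gradings and the quadratic equations along a curve. -/

namespace AdjointVariety

section Grading

variable {L : Type*} [LieRing L] [LieAlgebra ℂ L] {h : L}

/-- The elements of degree `k` in the grading of `L` by the eigenvalues of `ad h`. -/
def degree (h : L) (k : ℤ) : Submodule ℂ L := (ad ℂ L h).eigenspace (k : ℂ)

lemma mem_degree {k : ℤ} {y : L} : y ∈ degree h k ↔ ⁅h, y⁆ = (k : ℂ) • y := by
  simp [degree]

lemma lie_mem_degree' {j k l : ℤ} {x y : L} (hx : x ∈ degree h j) (hy : y ∈ degree h k)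
    (hl : j + k = l) : ⁅x, y⁆ ∈ degree h l := by
  subst hl
  rw [mem_degree] at *
  rw [leibniz_lie, hx, hy, smul_lie, lie_smul, ← add_smul]
  simp

lemma lie_mem_degree {j k : ℤ} {x y : L} (hx : x ∈ degree h j) (hy : y ∈ degree h k) :
    ⁅x, y⁆ ∈ degree h (j + k) :=
  lie_mem_degree' hx hy rfl

/-- The eigenvalues of `ad h` on `L` are integers between `-2` and `2`, and `ad h` is
diagonalizable. -/
def IsFiveGrading (h : L) : Prop := ⨆ k ∈ Finset.Icc (-2 : ℤ) 2, degree h k = ⊤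

namespace IsFiveGrading

variable (hh : IsFiveGrading h)
include hh

lemma isInternal : DirectSum.IsInternal (degree h) := by
  refine (DirectSum.isInternal_submodule_iff_iSupIndep_and_iSup_eq_top _).mpr ⟨?_, ?_⟩
  · exact (Module.End.eigenspaces_iSupIndep (ad ℂ L h)).comp Int.cast_injective
  · rw [eq_top_iff, ← hh]
    exact iSup₂_le fun k _ ↦ le_iSup _ k

/-- The component of degree `k` of an element of `L`. -/
noncomputable def proj (k : ℤ) : L →ₗ[ℂ] L :=
  letI := hh.isInternal.chooseDecomposition
  (degree h k).subtype ∘ₗ DirectSum.component ℂ ℤ _ k ∘ₗ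
    (DirectSum.decomposeLinearEquiv (degree h)).toLinearMap

lemma proj_mem (k : ℤ) (y : L) : hh.proj k y ∈ degree h k :=
  Submodule.coe_mem _

lemma proj_of_mem {k : ℤ} {y : L} (hy : y ∈ degree h k) : hh.proj k y = y :=
  letI := hh.isInternal.chooseDecomposition
  DirectSum.decompose_of_mem_same _ hy

lemma proj_of_mem_ne {j k : ℤ} {y : L} (hy : y ∈ degree h j) (hjk : j ≠ k) : hh.proj k y = 0 :=
  letI := hh.isInternal.chooseDecomposition
  DirectSum.decompose_of_mem_ne _ hy hjk

lemma sum_proj (y : L) : ∑ k ∈ Finset.Icc (-2 : ℤ) 2, hh.proj k y = y := by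
  have hy : y ∈ ⨆ k ∈ Finset.Icc (-2 : ℤ) 2, degree h k := hh ▸ Submodule.mem_top
  suffices hle : ⨆ k ∈ Finset.Icc (-2 : ℤ) 2, degree h k ≤
      LinearMap.eqLocus (∑ k ∈ Finset.Icc (-2 : ℤ) 2, hh.proj k) LinearMap.id by
    simpa using hle hy
  refine iSup₂_le fun k hk y hy ↦ ?_
  rw [LinearMap.mem_eqLocus, LinearMap.sum_apply, Finset.sum_eq_single_of_mem k hk]
  · exact hh.proj_of_mem hy
  · exact fun j _ hj ↦ hh.proj_of_mem_ne hy hj.symm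

lemma proj_eq_zero {k : ℤ} (hk : k ∉ Finset.Icc (-2 : ℤ) 2) (y : L) : hh.proj k y = 0 := by
  rw [← hh.sum_proj y, map_sum]
  exact Finset.sum_eq_zero fun j hj ↦
    hh.proj_of_mem_ne (hh.proj_mem j y) fun h ↦ hk (h ▸ hj)

lemma eq_zero_of_mem {k : ℤ} (hk : k ∉ Finset.Icc (-2 : ℤ) 2) {y : L} (hy : y ∈ degree h k) :
    y = 0 := by
  rw [← hh.proj_of_mem hy, hh.proj_eq_zero hk]

/-- If all components of `x` have degree at least `j` and all components of `y` have degree at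
least `k`, the component of degree `j + k` of `⁅x, y⁆` comes from the lowest components. -/
lemma proj_lie {j k : ℤ} {x y : L} (hx : ∀ i < j, hh.proj i x = 0)
    (hy : ∀ i < k, hh.proj i y = 0) :
    hh.proj (j + k) ⁅x, y⁆ = ⁅hh.proj j x, hh.proj k y⁆ := by
  have aux (a b : ℤ) (hab : a ≠ j ∨ b ≠ k) : hh.proj (j + k) ⁅hh.proj a x, hh.proj b y⁆ = 0 := by
    by_cases ha : a < j
    · simp [hx a ha]
    by_cases hb : b < k
    · simp [hy b hb]
    exact hh.proj_of_mem_ne (lie_mem_degree (hh.proj_mem a x) (hh.proj_mem b y)) (by omega)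
  have main (y' : L) (hy' : ∀ a, a ≠ j → hh.proj (j + k) ⁅hh.proj a x, y'⁆ = 0) :
      hh.proj (j + k) ⁅x, y'⁆ = hh.proj (j + k) ⁅hh.proj j x, y'⁆ := by
    conv_lhs => rw [← hh.sum_proj x, sum_lie, map_sum]
    by_cases hj : j ∈ Finset.Icc (-2 : ℤ) 2
    · exact Finset.sum_eq_single_of_mem j hj fun a _ ha ↦ hy' a ha
    · rw [hh.proj_eq_zero hj, zero_lie, map_zero]
      exact Finset.sum_eq_zero fun a ha ↦ hy' a fun h ↦ hj (h ▸ ha)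
  have key (a : ℤ) : hh.proj (j + k) ⁅hh.proj a x, y⁆ =
      hh.proj (j + k) ⁅hh.proj a x, hh.proj k y⁆ := by
    conv_lhs => rw [← hh.sum_proj y, lie_sum, map_sum]
    by_cases hk : k ∈ Finset.Icc (-2 : ℤ) 2
    · exact Finset.sum_eq_single_of_mem k hk fun b _ hb ↦ aux a b (.inr hb)
    · rw [hh.proj_eq_zero hk, lie_zero, map_zero]
      exact Finset.sum_eq_zero fun b hb ↦ aux a b (.inr fun h ↦ hk (h ▸ hb))
  rw [main y fun a ha ↦ by rw [key, aux a k (.inl ha)], key]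
  exact hh.proj_of_mem (lie_mem_degree (hh.proj_mem j x) (hh.proj_mem k y))

lemma proj_lie_eq_zero {j k : ℤ} {x y : L} (hx : ∀ i < j, hh.proj i x = 0)
    (hy : ∀ i < k, hh.proj i y = 0) : ∀ i < j + k, hh.proj i ⁅x, y⁆ = 0 := fun i hi ↦ by
  have := hh.proj_lie (j := j) (k := i - j) hx fun l hl ↦ hy l (by omega)
  rwa [add_sub_cancel, hy (i - j) (by omega), lie_zero] at this

lemma proj_lt_of_mem {k : ℤ} {y : L} (hy : y ∈ degree h k) : ∀ i < k, hh.proj i y = 0 :=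
  fun _ hi ↦ hh.proj_of_mem_ne hy hi.ne'

lemma proj_lt_neg_two (y : L) : ∀ i < -2, hh.proj i y = 0 :=
  fun i hi ↦ hh.proj_eq_zero (by simp; omega) y

lemma proj_lie_of_mem_left {j : ℤ} {x : L} (hx : x ∈ degree h j) (k : ℤ) (y : L) :
    hh.proj (j + k) ⁅x, y⁆ = ⁅x, hh.proj k y⁆ := by
  conv_lhs => rw [← hh.sum_proj y, lie_sum, map_sum]
  by_cases hk : k ∈ Finset.Icc (-2 : ℤ) 2
  · rw [Finset.sum_eq_single_of_mem k hk]
    · exact hh.proj_of_mem (lie_mem_degree hx (hh.proj_mem k y))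
    · exact fun b _ hb ↦ hh.proj_of_mem_ne (lie_mem_degree hx (hh.proj_mem b y)) (by omega)
  · rw [hh.proj_eq_zero hk, lie_zero]
    exact Finset.sum_eq_zero fun b hb ↦
      hh.proj_of_mem_ne (lie_mem_degree hx (hh.proj_mem b y)) fun h ↦ hk (by
        rwa [← add_left_cancel h])

lemma proj_lie_of_mem_right {j : ℤ} {x : L} (hx : x ∈ degree h j) (k : ℤ) (y : L) :
    hh.proj (k + j) ⁅y, x⁆ = ⁅hh.proj k y, x⁆ := by
  rw [← lie_skew, map_neg, add_comm, hh.proj_lie_of_mem_left hx, lie_skew]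

/-- If all components of `w` have positive degree and the fourth power of the adjoint action of
its component of degree one kills the elements of degree `-2`, then `(ad w) ^ 4 = 0`. -/
lemma ad_pow_four_eq_zero {w : L} (hw : ∀ i < 1, hh.proj i w = 0)
    (h4 : ∀ y ∈ degree h (-2), ⁅hh.proj 1 w, ⁅hh.proj 1 w, ⁅hh.proj 1 w, ⁅hh.proj 1 w, y⁆⁆⁆⁆ = 0)
    (y : L) : ⁅w, ⁅w, ⁅w, ⁅w, y⁆⁆⁆⁆ = 0 := by
  have h1 := hh.proj_lt_neg_two y
  have h2 := hh.proj_lie_eq_zero hw h1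
  have h3 := hh.proj_lie_eq_zero hw h2
  have h4' := hh.proj_lie_eq_zero hw h3
  have h5 := hh.proj_lie_eq_zero hw h4'
  rw [← hh.sum_proj ⁅w, ⁅w, ⁅w, ⁅w, y⁆⁆⁆⁆]
  refine Finset.sum_eq_zero fun k hk ↦ ?_
  -- Each bracket with `w` raises the lowest possible degree by one, from `-2` to `2`; only the
  -- component of degree `2` survives.
  rw [Finset.mem_Icc] at hk
  by_cases hk2 : k < 2
  · exact h5 k (by omega)
  obtain rfl : k = 1 + (1 + (1 + (1 + -2))) := by omega
  rw [hh.proj_lie hw h4', hh.proj_lie hw h3, hh.proj_lie hw h2, hh.proj_lie hw h1]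
  exact h4 _ (hh.proj_mem _ _)

end IsFiveGrading

/-- Interpolation at `0, ±1, ±2`: the scalars are those of the inverse Vandermonde matrix. -/
lemma coeff_eq_zero_of_forall {V : Type*} [AddCommGroup V] [Module ℂ V] {a₀ a₁ a₂ a₃ a₄ : V}
    (H : ∀ s : ℂ, a₀ + s • a₁ + s ^ 2 • a₂ + s ^ 3 • a₃ + s ^ 4 • a₄ = 0) :
    a₂ = 0 ∧ a₃ = 0 ∧ a₄ = 0 := by
  have h0 := H 0
  have h1 := H 1
  have h2 := H (-1)
  have h3 := H 2
  have h4 := H (-2)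
  refine ⟨?_, ?_, ?_⟩
  · linear_combination (norm := module) (2 / 3 : ℂ) • h1 + (2 / 3 : ℂ) • h2 - (1 / 24 : ℂ) • h3 -
      (1 / 24 : ℂ) • h4 - (5 / 4 : ℂ) • h0
  · linear_combination (norm := module) (1 / 12 : ℂ) • h3 - (1 / 12 : ℂ) • h4 - (1 / 6 : ℂ) • h1 +
      (1 / 6 : ℂ) • h2
  · linear_combination (norm := module) (1 / 24 : ℂ) • h3 + (1 / 24 : ℂ) • h4 - (1 / 6 : ℂ) • h1 -
      (1 / 6 : ℂ) • h2 + (1 / 4 : ℂ) • h0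

/-- The coefficients at `s²`, `s³`, `s⁴` of the equation `⁅x, ⁅x, f⁆⁆ = ψ x • x` on a curve
`s ↦ e + s w + s² u`. -/
lemma coeff_eq_of_curve {e f w u : L} (ψ : L →ₗ[ℂ] ℂ)
    (H : ∀ s : ℂ, ⁅e + s • w + s ^ 2 • u, ⁅e + s • w + s ^ 2 • u, f⁆⁆ =
      ψ (e + s • w + s ^ 2 • u) • (e + s • w + s ^ 2 • u)) :
    ⁅e, ⁅u, f⁆⁆ + ⁅u, ⁅e, f⁆⁆ + ⁅w, ⁅w, f⁆⁆ = ψ e • u + ψ w • w + ψ u • e ∧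
    ⁅w, ⁅u, f⁆⁆ + ⁅u, ⁅w, f⁆⁆ = ψ w • u + ψ u • w ∧ ⁅u, ⁅u, f⁆⁆ = ψ u • u := by
  obtain ⟨H2, H3, H4⟩ := coeff_eq_zero_of_forall
    (a₀ := ⁅e, ⁅e, f⁆⁆ - ψ e • e)
    (a₁ := ⁅e, ⁅w, f⁆⁆ + ⁅w, ⁅e, f⁆⁆ - (ψ e • w + ψ w • e))
    (a₂ := ⁅e, ⁅u, f⁆⁆ + ⁅u, ⁅e, f⁆⁆ + ⁅w, ⁅w, f⁆⁆ - (ψ e • u + ψ w • w + ψ u • e))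
    (a₃ := ⁅w, ⁅u, f⁆⁆ + ⁅u, ⁅w, f⁆⁆ - (ψ w • u + ψ u • w))
    (a₄ := ⁅u, ⁅u, f⁆⁆ - ψ u • u) fun s ↦ by
      rw [← sub_eq_zero.mpr (H s)]
      simp only [add_lie, lie_add, smul_lie, lie_smul, map_add, map_smul, smul_eq_mul]
      module
  exact ⟨sub_eq_zero.mp H2, sub_eq_zero.mp H3, sub_eq_zero.mp H4⟩

/-- If the curve `s ↦ e + s w + s² u` satisfies the quadratic equation `⁅x, ⁅x, f⁆⁆ = ψ x • x` of
the adjoint variety, where `w` has degree one, then `(ad w) ^ 3` kills `f`. -/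
theorem IsFiveGrading.lie_lie_lie_eq_zero (hh : IsFiveGrading h) {e f w u : L}
    (t : IsSl2Triple h e f) (hf : degree h (-2) ≤ Submodule.span ℂ {f}) (hw : w ∈ degree h 1)
    (ψ : L →ₗ[ℂ] ℂ) (hψe : ψ e = -2) (hψw : ψ w = 0)
    (H : ∀ s : ℂ, ⁅e + s • w + s ^ 2 • u, ⁅e + s • w + s ^ 2 • u, f⁆⁆ =
      ψ (e + s • w + s ^ 2 • u) • (e + s • w + s ^ 2 • u)) :
    ⁅w, ⁅w, ⁅w, f⁆⁆⁆ = 0 := by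
  have he : e ∈ degree h 2 := mem_degree.mpr (by simpa using t.lie_h_e_smul ℂ)
  have hf2 : f ∈ degree h (-2) := mem_degree.mpr (by simpa using t.lie_lie_smul_f ℂ)
  have hh0 : h ∈ degree h 0 := mem_degree.mpr (by simp)
  have hw' : ⁅w, f⁆ ∈ degree h (-1) := lie_mem_degree' hw hf2 (by norm_num)
  have hww' : ⁅w, ⁅w, f⁆⁆ ∈ degree h 0 := lie_mem_degree' hw hw' (by norm_num)
  obtain ⟨H2, H3, H4⟩ := coeff_eq_of_curve ψ H
  rw [t.lie_e_f, hψe, hψw, zero_smul, add_zero, ← sub_eq_zero] at H2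
  rw [hψw, zero_smul, zero_add] at H3
  -- The component of degree `k` of the `s²` equation. For `k = -2, -1` the first bracket vanishes,
  -- leaving `(2 - k) u_k = 0`.
  have K (k : ℤ) : ⁅e, ⁅hh.proj k u, f⁆⁆ + ⁅hh.proj k u, h⁆ + hh.proj k ⁅w, ⁅w, f⁆⁆ +
      (2 : ℂ) • hh.proj k u - ψ u • hh.proj k e = 0 := by
    have h1 := hh.proj_lie_of_mem_left he (k - 2) ⁅u, f⁆
    have h2 := hh.proj_lie_of_mem_right hf2 k u
    have h3 := hh.proj_lie_of_mem_right hh0 k u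
    rw [add_sub_cancel] at h1
    rw [add_zero] at h3
    rw [← sub_eq_add_neg] at h2
    have := congrArg (hh.proj k) H2
    simp only [map_sub, map_add, map_smul, map_zero, h1, h2, h3] at this
    rw [← this]
    module
  have hlie (k : ℤ) : ⁅hh.proj k u, h⁆ = (-k : ℂ) • hh.proj k u := by
    rw [← lie_skew, mem_degree.mp (hh.proj_mem k u), neg_smul]
  have hu2 : hh.proj (-2) u = 0 := by
    have h1 := K (-2)
    rw [hh.eq_zero_of_mem (k := -2 + -2) (by simp) (lie_mem_degree (hh.proj_mem (-2) u) hf2),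
      hlie, hh.proj_of_mem_ne hww' (by simp), hh.proj_of_mem_ne he (by simp)] at h1
    have h2 : (4 : ℂ) • hh.proj (-2) u = 0 := by
      rw [← h1]
      push_cast
      simp only [lie_zero]
      module
    exact (smul_eq_zero.mp h2).resolve_left (by norm_num)
  have hu1 : hh.proj (-1) u = 0 := by
    have h1 := K (-1)
    rw [hh.eq_zero_of_mem (k := -1 + -2) (by simp) (lie_mem_degree (hh.proj_mem (-1) u) hf2),
      hlie, hh.proj_of_mem_ne hww' (by simp), hh.proj_of_mem_ne he (by simp)] at h1
    have h2 : (3 : ℂ) • hh.proj (-1) u = 0 := by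
      rw [← h1]
      push_cast
      simp only [lie_zero]
      module
    exact (smul_eq_zero.mp h2).resolve_left (by norm_num)
  have hu : ∀ i < 0, hh.proj i u = 0 := fun i hi ↦ by
    by_cases h1 : i < -2
    · exact hh.proj_lt_neg_two u i h1
    · obtain rfl | rfl : i = -2 ∨ i = -1 := by omega
      exacts [hu2, hu1]
  have hfl := hh.proj_lt_of_mem hf2
  obtain ⟨l, hl⟩ := Submodule.mem_span_singleton.mp
    (hf (lie_mem_degree' (hh.proj_mem 0 u) hf2 (by norm_num)))
  have huf : hh.proj (0 + -2) ⁅u, f⁆ = ⁅hh.proj 0 u, f⁆ := by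
    rw [hh.proj_lie hu hfl, hh.proj_of_mem hf2]
  -- In degree `-2` the `s⁴` equation reads `l² f = ψ(u) u_{-2} = 0`.
  have hl0 : l = 0 := by
    have h1 := hh.proj_lie hu (hh.proj_lie_eq_zero hu hfl)
    rw [H4, huf, ← hl, lie_smul, ← hl, map_smul] at h1
    simp only [zero_add, hu2, smul_zero] at h1
    simpa [t.f_ne_zero] using h1.symm
  rw [hl0, zero_smul] at hl
  have h0 : hh.proj 0 u = (-1 / 2 : ℂ) • ⁅w, ⁅w, f⁆⁆ := by
    have h1 := K 0
    rw [← hl, hlie, hh.proj_of_mem hww', hh.proj_of_mem_ne he (by simp)] at h1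
    simp only [lie_zero, Int.cast_zero, neg_zero, zero_smul, smul_zero, sub_zero, zero_add] at h1
    linear_combination (norm := module) (1 / 2 : ℂ) • h1
  -- The `s³` equation in degree `-1`, with `u_0` proportional to `⁅w, ⁅w, f⁆⁆`. Applying `ad e`,
  -- which kills `⁅w, ⁅w, f⁆⁆` and sends `⁅w, f⁆` to `-w`, turns this into the claim.
  have h3 : ⁅⁅w, ⁅w, f⁆⁆, ⁅w, f⁆⁆ = 0 := by
    have h1 := congrArg (hh.proj (-1)) H3
    have h2 := hh.proj_lie_of_mem_left hw (-2) ⁅u, f⁆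
    have h4 := hh.proj_lie_of_mem_right hw' 0 u
    simp only [zero_add, Int.reduceAdd] at h2 h4 huf
    rw [huf, ← hl, lie_zero] at h2
    simp only [map_add, map_smul, h2, h4, zero_add,
      hh.proj_of_mem_ne hw (show (1 : ℤ) ≠ -1 by simp), smul_zero, h0, smul_lie] at h1
    exact (smul_eq_zero.mp h1).resolve_left (by norm_num)
  have hew : ⁅e, w⁆ = 0 := hh.eq_zero_of_mem (k := 2 + 1) (by simp) (lie_mem_degree he hw)
  have hew' : ⁅e, ⁅w, f⁆⁆ = -w := by
    rw [leibniz_lie, hew, zero_lie, zero_add, t.lie_e_f, ← lie_skew, mem_degree.mp hw]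
    simp
  have heww' : ⁅e, ⁅w, ⁅w, f⁆⁆⁆ = 0 := by
    rw [leibniz_lie, hew, hew', zero_lie, lie_neg, lie_self, neg_zero, add_zero]
  have h5 := congrArg (fun y ↦ ⁅e, y⁆) h3
  simp only [lie_zero] at h5
  rwa [leibniz_lie, heww', hew', zero_lie, zero_add, lie_neg, lie_skew] at h5

end Grading
end AdjointVariety

/-! ### Parametrized lines and conics; Zariski closedness. -/

namespace AdjointVariety

section Curves

variable {V : Type*} [AddCommGroup V] [Module ℂ V] {Z : Set (ℙ ℂ V)} {x w : V}

/-- A point of the affine cone over `Z`. -/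
def OnCone (Z : Set (ℙ ℂ V)) (p : V) : Prop := ∀ hp : p ≠ 0, Projectivization.mk ℂ p hp ∈ Z

lemma TangentToLine.sub_smul (h : TangentToLine Z x w) (c : ℂ) : TangentToLine Z x (w - c • x) := by
  obtain ⟨W, hW, hZ, hx, hw⟩ := h
  exact ⟨W, hW, hZ, hx, sub_mem hw (W.smul_mem c hx)⟩

lemma TangentToSmoothConic.sub_smul (h : TangentToSmoothConic Z x w) (c : ℂ) :
    TangentToSmoothConic Z x (w - c • x) := by
  obtain ⟨C, hC, x', w', rfl, rfl, hx, hw⟩ := h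
  refine ⟨C, hC, x', w' - c • x', rfl, by simp, hx, ?_⟩
  rw [sub_eq_add_neg, ← neg_smul, QuadraticMap.polar_add_right, QuadraticMap.polar_smul_right, hw,
    QuadraticMap.polar_self, hx]
  simp

lemma TangentToLine.exists_onCone (h : TangentToLine Z x w) :
    ∃ u : V, ∀ s : ℂ, OnCone Z (x + s • w + s ^ 2 • u) := by
  obtain ⟨W, -, hZ, hx, hw⟩ := h
  refine ⟨0, fun s hp ↦ hZ _ ?_⟩
  rw [Projectivization.submodule_mk, Submodule.span_singleton_le_iff_mem]
  simpa using add_mem hx (W.smul_mem s hw)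

/-- A smooth conic which is tangent to `w` at `[x]` has a quadratic parametrization
`s ↦ [x + s w + s² u]`. -/
lemma TangentToSmoothConic.exists_onCone (h : TangentToSmoothConic Z x w) (hx0 : x ≠ 0)
    (hw0 : w ∉ Submodule.span ℂ {x}) : ∃ u : V, ∀ s : ℂ, OnCone Z (x + s • w + s ^ 2 • u) := by
  obtain ⟨C, hC, x, w, rfl, rfl, hx, hw⟩ := h
  let B := QuadraticMap.polarBilin C.form
  have hB (y z : C.plane) : B y z = QuadraticMap.polar C.form y z := rfl
  -- If no such `z` exists, the functional of `x` is a multiple of that of `w`, and nondegeneracy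
  -- makes `x` itself a multiple of `w`.
  obtain ⟨z, hwz, hxz⟩ : ∃ z, B w z = 0 ∧ B x z = 1 := by
    by_cases hker : LinearMap.ker (B w) ≤ LinearMap.ker (B x)
    · have h1 := mem_span_of_iInf_ker_le_ker (ι := Unit) (L := fun _ ↦ B w) (K := B x) (by simpa)
      rw [Set.range_const, Submodule.mem_span_singleton] at h1
      obtain ⟨a, ha⟩ := h1
      have h2 : a • w - x = 0 := C.nondegenerate.1 _ fun y ↦ by
        change B (a • w - x) y = 0
        rw [map_sub, map_smul, ha, sub_self, LinearMap.zero_apply]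
      have h3 : a • (w : V) = x := by
        rw [← sub_eq_zero]
        exact congrArg Subtype.val h2
      have ha0 : a ≠ 0 := fun h0 ↦ hx0 (by rw [← h3, h0, zero_smul])
      refine (hw0 (Submodule.mem_span_singleton.mpr ⟨a⁻¹, ?_⟩)).elim
      rw [← h3, smul_smul, inv_mul_cancel₀ ha0, one_smul]
    · obtain ⟨z, hz, hz'⟩ := SetLike.not_le_iff_exists.mp hker
      rw [LinearMap.mem_ker] at hz hz'
      exact ⟨(B x z)⁻¹ • z, by simp [hz], by simp [hz']⟩
  rw [hB] at hwz hxz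
  -- With `Q` the form and `B` its polar, this solves `B(x, u) = -Q(w)`, `B(w, u) = 0`, `Q(u) = 0`,
  -- so every coefficient of `Q(x + s w + s² u)` vanishes.
  let u := -(C.form w) • z + (C.form w * C.form z) • x
  refine ⟨u, fun s hp ↦ hC ⟨x + s • w + s ^ 2 • u, ?_, by simp [Projectivization.submodule_mk]⟩⟩
  have hzx : QuadraticMap.polar C.form z x = 1 := by rw [QuadraticMap.polar_comm, hxz]
  have hwx : QuadraticMap.polar C.form w x = 0 := by rw [QuadraticMap.polar_comm, hw]
  have hxx : QuadraticMap.polar C.form x x = 0 := by rw [QuadraticMap.polar_self, hx, smul_zero]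
  have hadd (y z : C.plane) : C.form (y + z) = C.form y + C.form z + QuadraticMap.polar C.form y z :=
    QuadraticMap.map_add _ y z
  simp only [u, hadd, QuadraticMap.polar_add_left, QuadraticMap.polar_add_right,
    QuadraticMap.polar_smul_left, QuadraticMap.polar_smul_right, QuadraticMap.map_smul, hx, hw,
    hwz, hxz, hzx, hwx, hxx, smul_eq_mul]
  ring

end Curves

section ZariskiClosed

variable {L : Type*} [LieRing L] [LieAlgebra ℂ L] [FiniteDimensional ℂ L]

/-- Expanding `l x` in a basis shows that bracketing with a linear function preserves polynomiality
of coordinates; four iterations give `(ad w)⁴ y`. -/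
lemma exists_eval_eq_lie {V : Type*} [AddCommGroup V] [Module ℂ V] (l : V →ₗ[ℂ] L) {G : V → L}
    (hG : ∀ φ : Module.Dual ℂ L, ∃ p : MvPolynomial (Module.Dual ℂ V) ℂ,
      ∀ x, MvPolynomial.eval (fun ψ : Module.Dual ℂ V ↦ ψ x) p = φ (G x)) (φ : Module.Dual ℂ L) :
    ∃ p : MvPolynomial (Module.Dual ℂ V) ℂ,
      ∀ x, MvPolynomial.eval (fun ψ : Module.Dual ℂ V ↦ ψ x) p = φ ⁅l x, G x⁆ := by
  let b := Module.finBasis ℂ L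
  choose p hp using fun i ↦ hG (φ ∘ₗ (ad ℂ L (b i) : L →ₗ[ℂ] L))
  refine ⟨∑ i, MvPolynomial.X (b.coord i ∘ₗ l) * p i, fun x ↦ ?_⟩
  conv_rhs => rw [← b.sum_repr (l x), sum_lie, map_sum]
  simp [hp]

lemma isZariskiClosed_ad_pow_four :
    IsZariskiClosed {p : L × L | ∀ y : L, ⁅p.2, ⁅p.2, ⁅p.2, ⁅p.2, y⁆⁆⁆⁆ = 0} := by
  have key (y : L) (φ : Module.Dual ℂ L) : ∃ q : MvPolynomial (Module.Dual ℂ (L × L)) ℂ,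
      ∀ p : L × L, MvPolynomial.eval (fun ψ : Module.Dual ℂ (L × L) ↦ ψ p) q =
        φ ⁅p.2, ⁅p.2, ⁅p.2, ⁅p.2, y⁆⁆⁆⁆ := by
    refine exists_eval_eq_lie (LinearMap.snd ℂ L L) (fun φ ↦ ?_) φ
    refine exists_eval_eq_lie (LinearMap.snd ℂ L L) (fun φ ↦ ?_) φ
    refine exists_eval_eq_lie (LinearMap.snd ℂ L L) (fun φ ↦ ?_) φ
    exact exists_eval_eq_lie (LinearMap.snd ℂ L L) (fun φ ↦ ⟨MvPolynomial.C (φ y), by simp⟩) φ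
  choose q hq using key
  refine ⟨{f | ∃ y φ, f = q y φ}, ?_⟩
  ext p
  simp only [Set.mem_ofPred_eq, forall_exists_index]
  constructor
  · rintro h _ y φ rfl
    rw [hq, h, map_zero]
  · intro h y
    rw [← Module.forall_dual_apply_eq_zero_iff ℂ]
    intro φ
    rw [← hq]
    exact h _ y φ rfl

end ZariskiClosed

end AdjointVariety

/-! ### Equations of the adjoint variety and tangent directions. -/

namespace AdjointVariety

section RootSpaces

variable {L : Type*} [LieRing L] [LieAlgebra ℂ L] [FiniteDimensional ℂ L] [LieAlgebra.IsSimple ℂ L]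
  {H : LieSubalgebra ℂ L} [H.IsCartanSubalgebra]

lemma mem_degree_coroot (ρ : H.root) {χ : LieModule.Weight ℂ H L} {y : L} (hy : y ∈ rootSpace H χ)
    {k : ℤ} (hk : χ (coroot ρ.1) = k) : y ∈ degree (coroot ρ.1 : L) k := by
  rw [mem_degree, ← hk]
  exact lie_eq_smul_of_mem_rootSpace hy (coroot ρ.1)

lemma mem_degree_of_root (ρ : H.root) {α : H.root} {y : L} (hy : y ∈ rootSpace H α.1) :
    y ∈ degree (coroot ρ.1 : L) ((rootSystem H).pairingIn ℤ α ρ) :=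
  mem_degree_coroot ρ hy <| by
    have := (rootSystem H).algebraMap_pairingIn ℤ α ρ
    simpa using this.symm

lemma eq_top_of_forall_rootSpace_le {S : Submodule ℂ L}
    (hS : ∀ χ : LieModule.Weight ℂ H L, ∀ y ∈ rootSpace H χ, y ∈ S) : S = ⊤ := by
  rw [eq_top_iff, ← LieSubmodule.top_toSubmodule (R := ℂ) (L := H),
    ← LieModule.iSup_genWeightSpace_eq_top' ℂ H L, LieSubmodule.iSup_toSubmodule]
  exact iSup_le fun χ y hy ↦ hS χ y hy

lemma rootSpace_le_span {α : H.root} {e : L} (he : e ∈ rootSpace H α.1) (he0 : e ≠ 0) {y : L}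
    (hy : y ∈ rootSpace H α.1) : ∃ a : ℂ, a • e = y := by
  have h1 := finrank_rootSpace_eq_one α.1 (H.isNonZero_coe_root α)
  obtain ⟨a, ha⟩ := (finrank_eq_one_iff_of_nonzero' (⟨e, he⟩ : rootSpace H α.1)
    (by simpa using he0)).mp h1 ⟨y, hy⟩
  exact ⟨a, congrArg Subtype.val ha⟩

/-- Root spaces are lines, so a triple with another root vector is adapted to the given `e` by
moving the scalar to `f`. -/
lemma exists_isSl2Triple {α : H.root} {e : L} (he : e ∈ rootSpace H α.1) (he0 : e ≠ 0) :
    ∃ f ∈ rootSpace H (-α.1 : LieModule.Weight ℂ H L), IsSl2Triple (coroot α.1 : L) e f := by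
  have hα := H.isNonZero_coe_root α
  obtain ⟨h, e', f', t, he', hf'⟩ := exists_isSl2Triple_of_weight_isNonZero hα
  obtain rfl := t.h_eq_coroot hα he' hf'
  obtain ⟨a, rfl⟩ := rootSpace_le_span he he0 he'
  refine ⟨a • f', (rootSpace H _).smul_mem a (by simpa using hf'), t.h_ne_zero, ?_, ?_, ?_⟩
  · rw [lie_smul, ← smul_lie, t.lie_e_f]
  · have := lie_eq_smul_of_mem_rootSpace he (coroot α.1)
    rw [root_apply_coroot hα, two_smul] at this
    rwa [two_nsmul]
  · rw [lie_smul, t.lie_h_f_nsmul]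
    module

end RootSpaces

section HighestRoot

variable {L : Type*} [LieRing L] [LieAlgebra ℂ L] [FiniteDimensional ℂ L] [LieAlgebra.IsSimple ℂ L]
  {H : LieSubalgebra ℂ L} [H.IsCartanSubalgebra] {b : (rootSystem H).Base} {ρ : H.root}

lemma IsHighestRoot.isHighest (hρ : IsHighestRoot b ρ) : b.IsHighest ρ := hρ

namespace IsHighestRoot

variable (hρ : IsHighestRoot b ρ)
include hρ

/-- Every weight space lies in one of the degrees from `-2` to `2` with respect to the coroot of
the highest root `ρ`, and only the one of `-ρ` has degree `-2`. -/
lemma exists_degree (χ : LieModule.Weight ℂ H L) :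
    ∃ k ∈ Finset.Icc (-2 : ℤ) 2, (∀ y ∈ rootSpace H χ, y ∈ degree (coroot ρ.1 : L) k) ∧
      (k = -2 → χ = -ρ.1) := by
  by_cases hχ : χ.IsZero
  · exact ⟨0, by simp, fun y hy ↦ mem_degree_coroot ρ hy (by simp [hχ.eq]), by simp⟩
  let α : H.root := ⟨χ, by simpa using hχ⟩
  refine ⟨(rootSystem H).pairingIn ℤ α ρ, ?_, fun y hy ↦ mem_degree_of_root (α := α) ρ hy, ?_⟩
  · by_cases h1 : (rootSystem H).root α = (rootSystem H).root ρ
    · simp [(rootSystem H).root.injective h1]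
    by_cases h2 : (rootSystem H).root α = -(rootSystem H).root ρ
    · have : α = (rootSystem H).reflectionPerm ρ ρ :=
        (rootSystem H).root.injective <| by
          rw [RootPairing.root_reflectionPerm, RootPairing.reflection_apply_self, h2]
      rw [this, RootPairing.pairingIn_reflectionPerm_self_left]
      simp
    have h3 := hρ.isHighest.pairingIn_mem h1 h2
    simp only [Set.mem_insert_iff, Set.mem_singleton_iff] at h3
    rw [Finset.mem_Icc]
    omega
  · intro h
    have h1 := mt (hρ.isHighest.neg_one_le_pairingIn (i := α)) (by omega)
    rw [not_not] at h1
    ext x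
    exact LinearMap.congr_fun h1 x

lemma isFiveGrading : IsFiveGrading (coroot ρ.1 : L) := by
  refine eq_top_of_forall_rootSpace_le (H := H) fun χ y hy ↦ ?_
  obtain ⟨k, hk, hχ, -⟩ := hρ.exists_degree χ
  exact Submodule.mem_iSup_of_mem k (Submodule.mem_iSup_of_mem hk (hχ y hy))

lemma degree_neg_two_le {f : L} (hf : f ∈ rootSpace H (-ρ.1 : LieModule.Weight ℂ H L))
    (hf0 : f ≠ 0) : degree (coroot ρ.1 : L) (-2) ≤ Submodule.span ℂ {f} := by
  have hh := hρ.isFiveGrading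
  have htop : (Submodule.span ℂ {f}).comap (hh.proj (-2)) = ⊤ := by
    refine eq_top_of_forall_rootSpace_le (H := H) fun χ y hy ↦ ?_
    obtain ⟨k, hk, hχ, hk2⟩ := hρ.exists_degree χ
    by_cases h : k = -2
    · subst h
      rw [Submodule.mem_comap, hh.proj_of_mem (hχ y hy)]
      obtain rfl := hk2 rfl
      exact Submodule.mem_span_singleton.mpr (rootSpace_le_span
        (α := ⟨-ρ.1, by simpa using H.isNonZero_coe_root ρ⟩) hf hf0 hy)
    · rw [Submodule.mem_comap, hh.proj_of_mem_ne (hχ y hy) h]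
      exact zero_mem _
  intro y hy
  have : y ∈ (Submodule.span ℂ {f}).comap (hh.proj (-2)) := htop ▸ Submodule.mem_top
  rwa [Submodule.mem_comap, hh.proj_of_mem hy] at this

/-- The quadratic equations of the adjoint variety. -/
lemma exists_lie_lie_eq : ∃ c : ℂ, ∀ e ∈ rootSpace H ρ.1, ∀ y : L,
    ⁅e, ⁅e, y⁆⁆ = (c * killingForm ℂ L e y) • e := by
  have hh := hρ.isFiveGrading
  obtain ⟨e₀, he₀, he0⟩ := ρ.1.exists_ne_zero
  obtain ⟨f₀, hf₀, t⟩ := exists_isSl2Triple he₀ he0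
  have hκ : killingForm ℂ L e₀ f₀ ≠ 0 := fun h ↦ t.h_ne_zero <| by
    rw [← t.lie_e_f, lie_eq_killingForm_smul_of_mem_rootSpace_of_mem_rootSpace_neg he₀
      (by simpa using hf₀), h, zero_smul]
  -- Forced by `⁅e₀, ⁅e₀, f₀⁆⁆ = -2 e₀`. On the other weight spaces both sides vanish: the left by
  -- degree, the right because the Killing form pairs `𝔤_ρ` only with `𝔤_{-ρ}`.
  let c := -2 / killingForm ℂ L e₀ f₀
  have key (y : L) : ⁅e₀, ⁅e₀, y⁆⁆ = (c * killingForm ℂ L e₀ y) • e₀ := by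
    let T : L →ₗ[ℂ] L := (ad ℂ L e₀ : L →ₗ[ℂ] L) ∘ₗ (ad ℂ L e₀ : L →ₗ[ℂ] L) -
      (c • killingForm ℂ L e₀).smulRight e₀
    have htop : LinearMap.ker T = ⊤ := by
      refine eq_top_of_forall_rootSpace_le (H := H) fun χ y hy ↦ ?_
      suffices ⁅e₀, ⁅e₀, y⁆⁆ = (c * killingForm ℂ L e₀ y) • e₀ by
        simpa [T, sub_eq_zero] using this
      obtain ⟨k, hk, hχ, hk2⟩ := hρ.exists_degree χ
      by_cases h : χ = -ρ.1
      · subst h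
        obtain ⟨a, rfl⟩ := rootSpace_le_span
          (α := ⟨-ρ.1, by simpa using H.isNonZero_coe_root ρ⟩) hf₀ t.f_ne_zero hy
        rw [lie_smul, lie_smul, t.lie_e_f, ← lie_skew, t.lie_h_e_smul ℂ, map_smul, smul_eq_mul,
          smul_neg, smul_smul, ← neg_smul]
        congr 1
        simp only [c]
        field_simp
      · have he₀2 : e₀ ∈ degree (coroot ρ.1 : L) 2 :=
          mem_degree.mpr (by simpa using t.lie_h_e_smul ℂ)
        have hne : k ≠ -2 := fun h' ↦ h (hk2 h')
        rw [hh.eq_zero_of_mem (k := 2 + (2 + k)) (by simp at hk ⊢; omega)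
          (lie_mem_degree he₀2 (lie_mem_degree he₀2 (hχ y hy))),
          killingForm_apply_eq_zero_of_mem_rootSpace_of_add_ne_zero ℂ L H he₀ hy]
        · simp
        · intro h'
          apply h
          ext x
          have := congrFun h' x
          simp only [Pi.add_apply, Pi.zero_apply] at this
          simpa using eq_neg_of_add_eq_zero_right this
    have : y ∈ LinearMap.ker T := htop ▸ Submodule.mem_top
    simpa [T, sub_eq_zero] using this
  refine ⟨c, fun e he y ↦ ?_⟩
  obtain ⟨a, rfl⟩ := rootSpace_le_span he₀ he0 he
  simp only [smul_lie, lie_smul, key, map_smul, LinearMap.smul_apply, smul_eq_mul]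
  module

omit hρ in
-- Automorphisms preserve the bracket and the Killing form, so the equations pass from `𝔤_ρ` to its
-- whole orbit.
lemma lie_lie_eq_of_onCone {c : ℂ} (hc : ∀ e ∈ rootSpace H ρ.1, ∀ y : L,
    ⁅e, ⁅e, y⁆⁆ = (c * killingForm ℂ L e y) • e) {p : L} (hp : OnCone (adjointVariety ρ) p) (y : L) :
    ⁅p, ⁅p, y⁆⁆ = (c * killingForm ℂ L p y) • p := by
  by_cases hp0 : p = 0
  · simp [hp0]
  obtain ⟨g, -, hg⟩ := hp hp0
  have hpg : p ∈ (rootSpace H ρ.1).toSubmodule.map ((g : L →ₗ⁅ℂ⁆ L) : L →ₗ[ℂ] L) := by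
    rw [← hg, Projectivization.submodule_mk]
    exact Submodule.mem_span_singleton_self p
  obtain ⟨e, he, rfl⟩ := hpg
  obtain ⟨y, rfl⟩ := g.surjective y
  have := congrArg g (hc e he y)
  simp only [LieEquiv.map_lie, map_smul] at this
  rw [← killingForm_of_equiv_apply g] at this
  exact this

omit hρ in
lemma contactFiber_le : contactFiber ρ ≤ degree (coroot ρ.1 : L) (-1) :=
  iSup₂_le fun α hα y hy ↦ mem_degree_coroot ρ hy (by simpa using hα)

omit hρ in
lemma mem_degree_two {e : L} (he : e ∈ rootSpace H ρ.1) : e ∈ degree (coroot ρ.1 : L) 2 :=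
  mem_degree_coroot ρ he (by simp [root_apply_coroot (H.isNonZero_coe_root ρ)])

/-- If a direction `w` of the contact distribution is tangent to a line or to a smooth conic in the
adjoint variety, then `(ad w) ^ 4 = 0`. -/
theorem lie_pow_four_eq_zero {x w : L} (hxw : (x, w) ∈ contactDirections ρ)
    (h : TangentToLine (adjointVariety ρ) x w ∨ TangentToSmoothConic (adjointVariety ρ) x w)
    (y : L) : ⁅w, ⁅w, ⁅w, ⁅w, y⁆⁆⁆⁆ = 0 := by
  obtain ⟨g, -, e, he, v, hv, a, rfl, rfl, hx0, hw0⟩ := hxw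
  have he0 : e ≠ 0 := by
    rintro rfl
    simp at hx0
  have hh := hρ.isFiveGrading
  have hw : ⁅v, e⁆ ∈ degree (coroot ρ.1 : L) 1 :=
    lie_mem_degree' (contactFiber_le hv) (mem_degree_two he) (by norm_num)
  -- Tangency depends on `w` only modulo the base point; dropping `a • g e` leaves the image under
  -- `g` of an element of degree `1`.
  obtain ⟨u, hu⟩ : ∃ u, ∀ s : ℂ, OnCone (adjointVariety ρ) (g e + s • g ⁅v, e⁆ + s ^ 2 • u) := by
    have hga : g ⁅v, e⁆ + a • g e - a • g e = g ⁅v, e⁆ := add_sub_cancel_right _ _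
    have hw0' : g ⁅v, e⁆ ∉ Submodule.span ℂ {g e} := fun h' ↦
      hw0 (add_mem h' (Submodule.smul_mem _ a (Submodule.mem_span_singleton_self _)))
    rcases h with h | h
    · have := (h.sub_smul a).exists_onCone
      rwa [hga] at this
    · have := h.sub_smul a
      rw [hga] at this
      exact this.exists_onCone hx0 hw0'
  obtain ⟨u, rfl⟩ : ∃ u', g u' = u := g.surjective u
  obtain ⟨f, hf, t⟩ := exists_isSl2Triple he he0
  obtain ⟨c, hc⟩ := hρ.exists_lie_lie_eq
  have hfdeg := hρ.degree_neg_two_le hf t.f_ne_zero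
  have h3 : ⁅⁅v, e⁆, ⁅⁅v, e⁆, ⁅⁅v, e⁆, f⁆⁆⁆ = 0 := by
    refine hh.lie_lie_lie_eq_zero t hfdeg hw (c • (killingForm ℂ L).flip f) (u := u) ?_ ?_ ?_
    · have h1 := hc e he f
      rw [t.lie_e_f, ← lie_skew, t.lie_h_e_smul ℂ, ← neg_smul] at h1
      simpa using (smul_left_injective ℂ he0 h1).symm
    · have h1 : killingForm ℂ L ⁅v, e⁆ f = 0 := by
        rw [LieModule.traceForm_apply_lie_apply, t.lie_e_f]
        have h2 := LieModule.traceForm_apply_lie_apply ℂ L L v (coroot ρ.1 : L) (coroot ρ.1 : L)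
        rw [lie_self, map_zero, ← lie_skew, mem_degree.mp (contactFiber_le hv)] at h2
        simpa using h2
      simp [h1]
    · intro s
      have h1 := lie_lie_eq_of_onCone hc (hu s) (g f)
      have h2 : g e + s • g ⁅v, e⁆ + s ^ 2 • g u = g (e + s • ⁅v, e⁆ + s ^ 2 • u) := by simp
      rw [h2, killingForm_of_equiv_apply, ← LieEquiv.map_lie, ← LieEquiv.map_lie, ← map_smul] at h1
      exact g.injective h1
  have hsum : g ⁅v, e⁆ + a • g e = g (⁅v, e⁆ + a • e) := by simp
  obtain ⟨y, rfl⟩ : ∃ y', g y' = y := g.surjective y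
  rw [hsum]
  simp only [← LieEquiv.map_lie]
  rw [hh.ad_pow_four_eq_zero, map_zero]
  · intro i hi
    rw [map_add, map_smul, hh.proj_of_mem_ne hw (by omega),
      hh.proj_of_mem_ne (mem_degree_two he) (by omega), smul_zero, add_zero]
  · intro y hy
    rw [map_add, map_smul, hh.proj_of_mem hw,
      hh.proj_of_mem_ne (mem_degree_two he) (by omega), smul_zero, add_zero]
    obtain ⟨l, rfl⟩ := Submodule.mem_span_singleton.mp (hfdeg hy)
    simp only [lie_smul, h3, lie_zero, smul_zero]

end IsHighestRoot

end HighestRoot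

end AdjointVariety

/-! ### The `A₂` computation and the explicit directions. -/

namespace AdjointVariety

/-- A computation in a Lie algebra of type `A₂`, with simple root vectors `A`, `B` and lowest root
vector `e`. -/
lemma lie_pow_four_ne_zero_of_isSl2Triple {L : Type*} [LieRing L] [LieAlgebra ℂ L]
    {h e f A B hA hB : L} (t : IsSl2Triple h e f) {k p q : ℂ} (hA0 : A ≠ 0) (hB0 : B ≠ 0)
    (hp : p ≠ 0) (hhA : ⁅h, A⁆ = -A) (hhB : ⁅h, B⁆ = -B) (hAf : ⁅A, f⁆ = 0) (hBf : ⁅B, f⁆ = 0)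
    (hAA : ⁅hA, A⁆ = (2 : ℂ) • A) (hAB : ⁅hA, B⁆ = -B) (hAe : ⁅hA, e⁆ = -e)
    (hBA : ⁅hB, A⁆ = -A) (hBB : ⁅hB, B⁆ = (2 : ℂ) • B) (hBe : ⁅hB, e⁆ = -e)
    (hk : ⁅A, B⁆ = k • f) (hXA : ⁅⁅A, e⁆, A⁆ = 0) (hYB : ⁅⁅B, e⁆, B⁆ = 0)
    (hXB : ⁅⁅A, e⁆, B⁆ = p • hB) (hYA : ⁅⁅B, e⁆, A⁆ = q • hA) :
    ⁅⁅A + B, e⁆, ⁅⁅A + B, e⁆, ⁅⁅A + B, e⁆, ⁅⁅A + B, e⁆, f⁆⁆⁆⁆ ≠ 0 := by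
  have hXf : ⁅⁅A, e⁆, f⁆ = A := by
    rw [lie_lie, t.lie_e_f, hAf, lie_zero, sub_zero, ← lie_skew, hhA, neg_neg]
  have hYf : ⁅⁅B, e⁆, f⁆ = B := by
    rw [lie_lie, t.lie_e_f, hBf, lie_zero, sub_zero, ← lie_skew, hhB, neg_neg]
  have hfe : ⁅f, e⁆ = -h := by rw [← lie_skew, t.lie_e_f]
  -- The Jacobi identity for `A`, `B`, `e`. Bracketing with `A` and with `B` gives two linear
  -- relations, whence `q = -p` and `k = p`.
  have hrel : p • hB - q • hA = -(k • h) := by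
    rw [← hXB, ← hYA, ← smul_neg, ← hfe, ← smul_lie, ← hk, ← lie_skew ⁅A, B⁆ e, leibniz_lie e A B,
      ← lie_skew e A, ← lie_skew e B, lie_neg, neg_lie, ← lie_skew A ⁅B, e⁆]
    abel
  have h1 : -p - 2 * q = k := by
    have := congrArg (fun y ↦ ⁅y, A⁆) hrel
    simp only [sub_lie, smul_lie, hBA, hAA, hhA, smul_neg, neg_neg, smul_smul,
      ← neg_smul, ← sub_smul] at this
    have := smul_left_injective ℂ hA0 this
    linear_combination this
  have h2 : 2 * p + q = k := by
    have := congrArg (fun y ↦ ⁅y, B⁆) hrel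
    simp only [sub_lie, smul_lie, hBB, hAB, hhB, smul_neg, neg_neg, smul_smul,
      ← neg_smul, ← sub_smul] at this
    have := smul_left_injective ℂ hB0 this
    linear_combination this
  obtain rfl : q = -p := by linear_combination (1 / 3 : ℂ) * (h2 - h1)
  obtain rfl : k = p := by linear_combination -h2
  have hAX : ⁅⁅A, e⁆, hA⁆ = -⁅A, e⁆ := by
    rw [← lie_skew, leibniz_lie, hAA, hAe, smul_lie, lie_neg]
    module
  have hBX : ⁅⁅A, e⁆, hB⁆ = (2 : ℂ) • ⁅A, e⁆ := by
    rw [← lie_skew, leibniz_lie, hBA, hBe, neg_lie, lie_neg]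
    module
  have hAY : ⁅⁅B, e⁆, hA⁆ = (2 : ℂ) • ⁅B, e⁆ := by
    rw [← lie_skew, leibniz_lie, hAB, hAe, neg_lie, lie_neg]
    module
  have hBY : ⁅⁅B, e⁆, hB⁆ = -⁅B, e⁆ := by
    rw [← lie_skew, leibniz_lie, hBB, hBe, smul_lie, lie_neg]
    module
  have hXY : ⁅⁅⁅A, e⁆, ⁅B, e⁆⁆, f⁆ = -(k • h) := by
    rw [lie_lie, hXf, hYf, hXB, hYA, hrel]
  rw [add_lie A B e]
  generalize ⁅A, e⁆ = X at *
  generalize ⁅B, e⁆ = Y at *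
  have hXY0 : ⁅X, Y⁆ ≠ 0 := fun h0 ↦ by
    rw [h0, zero_lie, eq_comm, neg_eq_zero, smul_eq_zero] at hXY
    exact hXY.elim hp t.h_ne_zero
  -- The string under `ad (X + Y)` is `f`, `A + B`, `k (hB - hA)`, `3k (X - Y)`, `-6k ⁅X, Y⁆`.
  have hwf : ⁅X + Y, f⁆ = A + B := by rw [add_lie, hXf, hYf]
  have hwv : ⁅X + Y, A + B⁆ = k • hB - k • hA := by
    rw [add_lie, lie_add, lie_add, hXA, hXB, hYA, hYB]
    module
  have hw1 : ⁅X + Y, k • hB - k • hA⁆ = (3 * k) • (X - Y) := by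
    rw [lie_sub, lie_smul, lie_smul, add_lie, add_lie, hAX, hBX, hAY, hBY]
    module
  have hw2 : ⁅X + Y, (3 * k) • (X - Y)⁆ = (-6 * k) • ⁅X, Y⁆ := by
    rw [lie_smul, add_lie, lie_sub, lie_sub, lie_self, lie_self, ← lie_skew Y X]
    module
  rw [hwf, hwv, hw1, hw2]
  exact smul_ne_zero (mul_ne_zero (by norm_num) hp) hXY0

section HighestRoot

variable {L : Type*} [LieRing L] [LieAlgebra ℂ L] [FiniteDimensional ℂ L] [LieAlgebra.IsSimple ℂ L]
  {H : LieSubalgebra ℂ L} [H.IsCartanSubalgebra] {b : (rootSystem H).Base} {ρ : H.root}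

lemma mem_contactDirections {g : L ≃ₗ⁅ℂ⁆ L} (hg : InAdjointGroup L g) {e v : L}
    (he : e ∈ rootSpace H ρ.1) (hv : v ∈ contactFiber ρ) (he0 : e ≠ 0)
    (hve : ⁅v, e⁆ ∉ Submodule.span ℂ {e}) : (g e, g ⁅v, e⁆) ∈ contactDirections ρ := by
  refine ⟨g, hg, e, he, v, hv, 0, rfl, by simp, ?_, fun h ↦ hve ?_⟩
  · simpa using he0
  · obtain ⟨a, ha⟩ := Submodule.mem_span_singleton.mp h
    refine Submodule.mem_span_singleton.mpr ⟨a, g.injective ?_⟩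
    exact (map_smul g a e).trans ha

/-- If `⟨ρ, α⟩ = -1` for a long root `α`, then `2α + ρ` is not a root. -/
lemma lie_lie_self_eq_zero {α : H.root} (hα : (rootSystem H).IsLong α)
    (hρα : (rootSystem H).pairingIn ℤ ρ α = -1) {A e : L} (hA : A ∈ rootSpace H α.1)
    (he : e ∈ rootSpace H ρ.1) : ⁅⁅A, e⁆, A⁆ = 0 := by
  have hmem := lie_mem_genWeightSpace_of_mem_genWeightSpace
    (lie_mem_genWeightSpace_of_mem_genWeightSpace hA he) hA
  by_contra hne
  let χ : LieModule.Weight ℂ H L := ⟨(α.1 : H → ℂ) + ρ.1 + α.1, fun h0 ↦ hne (by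
    rw [h0] at hmem
    simpa using hmem)⟩
  -- The weight `2α + ρ` pairs with the coroot of `α` to `4 - 1`, too large against a long root.
  have h3 : χ (coroot α.1) = 3 := by
    have h1 : ρ.1 (coroot α.1) = -1 := by
      have := (rootSystem H).algebraMap_pairingIn ℤ ρ α
      rw [hρα] at this
      simpa using this.symm
    change α.1 (coroot α.1) + ρ.1 (coroot α.1) + α.1 (coroot α.1) = 3
    rw [root_apply_coroot (H.isNonZero_coe_root α), h1]
    norm_num
  have hχ : χ.IsNonZero := fun h0 ↦ by
    rw [h0.eq] at h3
    simp at h3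
  let θ : H.root := ⟨χ, by simpa using hχ⟩
  have hθ : (rootSystem H).pairingIn ℤ θ α = 3 := by
    apply FaithfulSMul.algebraMap_injective ℤ ℂ
    rw [RootPairing.algebraMap_pairingIn]
    simpa using h3
  by_cases h1 : (rootSystem H).root θ = (rootSystem H).root α
  · rw [(rootSystem H).root.injective h1] at hθ
    simp at hθ
  by_cases h2 : (rootSystem H).root θ = -(rootSystem H).root α
  · have : θ = (rootSystem H).reflectionPerm α α := (rootSystem H).root.injective <| by
      rw [RootPairing.root_reflectionPerm, RootPairing.reflection_apply_self, h2]
    rw [this, RootPairing.pairingIn_reflectionPerm_self_left] at hθ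
    simp at hθ
  have := hα.pairingIn_mem h1 h2
  rw [hθ] at this
  simp at this

lemma exists_lie_eq_smul_coroot {β : H.root} {B X : L} (hB : B ∈ rootSpace H β.1) (hB0 : B ≠ 0)
    (hX : X ∈ rootSpace H (-β.1 : LieModule.Weight ℂ H L)) (hX0 : X ≠ 0) :
    ∃ p : ℂ, p ≠ 0 ∧ ⁅X, B⁆ = p • (coroot β.1 : L) := by
  obtain ⟨f, hf, t⟩ := exists_isSl2Triple hB hB0
  obtain ⟨a, rfl⟩ := rootSpace_le_span
    (α := ⟨-β.1, by simpa using H.isNonZero_coe_root β⟩) hf t.f_ne_zero hX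
  refine ⟨-a, neg_ne_zero.mpr fun h ↦ hX0 (by simp [h]), ?_⟩
  rw [smul_lie, ← lie_skew, t.lie_e_f, smul_neg, neg_smul]

namespace IsHighestRoot

variable (hρ : IsHighestRoot b ρ)
include hρ

/-- The three roots `α`, `β`, `ρ` with `α + β + ρ = 0`, where `α` is long, span a root system of
type `A₂`. -/
lemma pairingIn_eq {α β : H.root} (hα : (rootSystem H).IsLong α)
    (hβ : (rootSystem H).root β = -(rootSystem H).root α - (rootSystem H).root ρ) :
    (rootSystem H).IsLong β ∧ (rootSystem H).pairingIn ℤ α ρ = -1 ∧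
    (rootSystem H).pairingIn ℤ β ρ = -1 ∧ (rootSystem H).pairingIn ℤ ρ α = -1 ∧
    (rootSystem H).pairingIn ℤ ρ β = -1 ∧ (rootSystem H).pairingIn ℤ α β = -1 ∧
    (rootSystem H).pairingIn ℤ β α = -1 := by
  have hsum (γ : H.root) : (rootSystem H).pairingIn ℤ β γ = -(rootSystem H).pairingIn ℤ α γ - (rootSystem H).pairingIn ℤ ρ γ := by
    apply FaithfulSMul.algebraMap_injective ℤ ℂ
    rw [RootPairing.algebraMap_pairingIn, ← RootPairing.root_coroot_eq_pairing, hβ, map_sub,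
      map_neg, LinearMap.sub_apply, LinearMap.neg_apply, RootPairing.root_coroot_eq_pairing,
      RootPairing.root_coroot_eq_pairing, map_sub, map_neg, RootPairing.algebraMap_pairingIn,
      RootPairing.algebraMap_pairingIn]
  have h1 := hρ.isHighest.neg_one_le_pairingIn (i := α) fun h ↦ (rootSystem H).ne_zero β (by
    rw [hβ, h, neg_neg, sub_self])
  have h2 := hρ.isHighest.neg_one_le_pairingIn (i := β) fun h ↦ (rootSystem H).ne_zero α (by
    rw [hβ] at h
    rwa [sub_eq_add_neg, add_eq_right, neg_eq_zero] at h)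
  have h3 := hsum ρ
  rw [(rootSystem H).pairingIn_same] at h3
  -- The pairings of `α` and `β` with `ρ` sum to `-2`, and each is at least `-1`.
  have hαρ : (rootSystem H).pairingIn ℤ α ρ = -1 := by omega
  have hlong {γ δ : H.root} (hγ : (rootSystem H).IsLong γ) (h : (rootSystem H).pairingIn ℤ γ δ = -1) :
      (rootSystem H).pairingIn ℤ δ γ = -1 := by
    have h4 : (rootSystem H).pairingIn ℤ δ γ < 0 := by
      rw [(rootSystem H).pairingIn_lt_zero_iff]
      omega
    by_cases h5 : (rootSystem H).root δ = (rootSystem H).root γ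
    · rw [(rootSystem H).root.injective h5] at h
      simp at h
    by_cases h6 : (rootSystem H).root δ = -(rootSystem H).root γ
    · have : δ = (rootSystem H).reflectionPerm γ γ := (rootSystem H).root.injective <| by
        rw [RootPairing.root_reflectionPerm, RootPairing.reflection_apply_self, h6]
      rw [this, RootPairing.pairingIn_reflectionPerm_self_right] at h
      simp at h
    have := hγ.pairingIn_mem h5 h6
    simp only [Set.mem_insert_iff, Set.mem_singleton_iff] at this
    omega
  have hρα := hlong hα hαρ
  have hβα : (rootSystem H).pairingIn ℤ β α = -1 := by
    rw [hsum, hρα, (rootSystem H).pairingIn_same]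
    norm_num
  have hβlong : (rootSystem H).IsLong β := by
    -- The reflection in `ρ` sends `α` to `α + ρ = -β`, so `β` is conjugate to `α` under the Weyl
    -- group.
    have : β = (rootSystem H).reflectionPerm ((rootSystem H).reflectionPerm ρ α) ((rootSystem H).reflectionPerm ρ α) := by
      refine (rootSystem H).root.injective ?_
      rw [RootPairing.root_reflectionPerm, RootPairing.reflection_apply_self,
        RootPairing.root_reflectionPerm, RootPairing.reflection_apply_root' ℤ, hαρ, hβ]
      module
    rw [this]
    exact (hα.reflectionPerm _).reflectionPerm _
  exact ⟨hβlong, hαρ, by omega, hρα, hlong hβlong (by omega), hlong hβlong hβα, hβα⟩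

omit hρ in
lemma pairing_eq_neg_one {α β : H.root} (h : (rootSystem H).pairingIn ℤ α β = -1) :
    (rootSystem H).pairing α β = -1 := by
  rw [← (rootSystem H).algebraMap_pairingIn ℤ, h]
  simp

theorem add_mem_contactFiber {α β : H.root} (hα : (rootSystem H).IsLong α)
    (hβ : (rootSystem H).root β = -(rootSystem H).root α - (rootSystem H).root ρ)
    {A B : L} (hA : A ∈ rootSpace H α.1) (hB : B ∈ rootSpace H β.1) : A + B ∈ contactFiber ρ := by
  obtain ⟨-, h1, h2, -⟩ := hρ.pairingIn_eq hα hβ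
  exact add_mem
    (Submodule.mem_iSup_of_mem α (Submodule.mem_iSup_of_mem (pairing_eq_neg_one h1) hA))
    (Submodule.mem_iSup_of_mem β (Submodule.mem_iSup_of_mem (pairing_eq_neg_one h2) hB))

theorem exists_lie_pow_four_ne_zero {α β : H.root} (hα : (rootSystem H).IsLong α)
    (hβ : (rootSystem H).root β = -(rootSystem H).root α - (rootSystem H).root ρ)
    {A B e : L} (hA : A ∈ rootSpace H α.1) (hB : B ∈ rootSpace H β.1) (he : e ∈ rootSpace H ρ.1)
    (hA0 : A ≠ 0) (hB0 : B ≠ 0) (he0 : e ≠ 0) :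
    ∃ y : L, ⁅⁅A + B, e⁆, ⁅⁅A + B, e⁆, ⁅⁅A + B, e⁆, ⁅⁅A + B, e⁆, y⁆⁆⁆⁆ ≠ 0 := by
  obtain ⟨hβl, hαρ, hβρ, hρα, hρβ, hαβ, hβα⟩ := hρ.pairingIn_eq hα hβ
  have hh := hρ.isFiveGrading
  obtain ⟨f, hf, t⟩ := exists_isSl2Triple he he0
  have hlie {γ δ : H.root} (h : (rootSystem H).pairingIn ℤ γ δ = -1) {y : L}
      (hy : y ∈ rootSpace H γ.1) : ⁅(coroot δ.1 : L), y⁆ = -y := by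
    have := mem_degree.mp (mem_degree_of_root δ hy)
    rw [h] at this
    simpa using this
  have hself {γ : H.root} {y : L} (hy : y ∈ rootSpace H γ.1) :
      ⁅(coroot γ.1 : L), y⁆ = (2 : ℂ) • y := by
    have := mem_degree.mp (mem_degree_of_root γ hy)
    simpa using this
  have hAdeg : A ∈ degree (coroot ρ.1 : L) (-1) := hαρ ▸ mem_degree_of_root ρ hA
  have hBdeg : B ∈ degree (coroot ρ.1 : L) (-1) := hβρ ▸ mem_degree_of_root ρ hB
  have hfdeg : f ∈ degree (coroot ρ.1 : L) (-2) := mem_degree.mpr (by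
    simpa using t.lie_lie_smul_f ℂ)
  have hAf : ⁅A, f⁆ = 0 := hh.eq_zero_of_mem (k := -1 + -2) (by simp) (lie_mem_degree hAdeg hfdeg)
  have hBf : ⁅B, f⁆ = 0 := hh.eq_zero_of_mem (k := -1 + -2) (by simp) (lie_mem_degree hBdeg hfdeg)
  obtain ⟨k, hk⟩ := Submodule.mem_span_singleton.mp <|
    hρ.degree_neg_two_le hf t.f_ne_zero (lie_mem_degree' hAdeg hBdeg (by norm_num))
  have hbr {γ : H.root} (hγρ : (rootSystem H).pairingIn ℤ γ ρ = -1) {C : L}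
      (hC : C ∈ rootSpace H γ.1) (hC0 : C ≠ 0) (hCf : ⁅C, f⁆ = 0) : ⁅C, e⁆ ≠ 0 := fun h0 ↦ by
    have h1 := lie_lie C e f
    rw [h0, hCf, t.lie_e_f, zero_lie, lie_zero, sub_zero, ← lie_skew, hlie hγρ hC, neg_neg] at h1
    exact hC0 h1.symm
  have hX : ⁅A, e⁆ ∈ rootSpace H (-β.1 : LieModule.Weight ℂ H L) := by
    have : ((-β.1 : LieModule.Weight ℂ H L) : H → ℂ) = α.1 + ρ.1 := by
      ext x
      have := LinearMap.congr_fun hβ x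
      simp at this ⊢
      rw [this]
      ring
    rw [this]
    exact lie_mem_genWeightSpace_of_mem_genWeightSpace hA he
  have hY : ⁅B, e⁆ ∈ rootSpace H (-α.1 : LieModule.Weight ℂ H L) := by
    have : ((-α.1 : LieModule.Weight ℂ H L) : H → ℂ) = β.1 + ρ.1 := by
      ext x
      have := LinearMap.congr_fun hβ x
      simp at this ⊢
      rw [this]
      ring
    rw [this]
    exact lie_mem_genWeightSpace_of_mem_genWeightSpace hB he
  obtain ⟨p, hp, hXB⟩ := exists_lie_eq_smul_coroot hB hB0 hX (hbr hαρ hA hA0 hAf)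
  obtain ⟨q, -, hYA⟩ := exists_lie_eq_smul_coroot hA hA0 hY (hbr hβρ hB hB0 hBf)
  exact ⟨f, lie_pow_four_ne_zero_of_isSl2Triple t hA0 hB0 hp (hlie hαρ hA) (hlie hβρ hB) hAf hBf
    (hself hA) (hlie hβα hB) (hlie hρα he) (hlie hαβ hA) (hself hB) (hlie hρβ he) hk.symm
    (lie_lie_self_eq_zero hα hρα hA he) (lie_lie_self_eq_zero hβl hρβ hB he) hXB hYA⟩

/-- The bracket has degree `1` and `e` has degree `2`, so a proportional bracket would be zero,
against its nonzero fourth power. -/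
theorem lie_notMem_span {α β : H.root} (hα : (rootSystem H).IsLong α)
    (hβ : (rootSystem H).root β = -(rootSystem H).root α - (rootSystem H).root ρ)
    {A B e : L} (hA : A ∈ rootSpace H α.1) (hB : B ∈ rootSpace H β.1) (he : e ∈ rootSpace H ρ.1)
    (hA0 : A ≠ 0) (hB0 : B ≠ 0) (he0 : e ≠ 0) : ⁅A + B, e⁆ ∉ Submodule.span ℂ {e} := fun h ↦ by
  have hh := hρ.isFiveGrading
  have hw : ⁅A + B, e⁆ ∈ degree (coroot ρ.1 : L) 1 :=
    lie_mem_degree' (contactFiber_le (hρ.add_mem_contactFiber hα hβ hA hB)) (mem_degree_two he)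
      (by norm_num)
  obtain ⟨a, ha⟩ := Submodule.mem_span_singleton.mp h
  have h1 := hh.proj_of_mem hw
  rw [← ha, map_smul, hh.proj_of_mem_ne (mem_degree_two he) (by omega), smul_zero, ha] at h1
  obtain ⟨y, hy⟩ := hρ.exists_lie_pow_four_ne_zero hα hβ hA hB he hA0 hB0 he0
  simp [← h1] at hy

theorem exists_long (hC : ¬ IsTypeC b) :
    ∃ (j₀ : b.support) (α β : H.root), (rootSystem H).pairing j₀ ρ ≠ 0 ∧
      (rootSystem H).IsLong α ∧ simpleCoeff b j₀ α = -1 ∧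
      (rootSystem H).root β = -(rootSystem H).root α - (rootSystem H).root ρ := by
  obtain ⟨δ, hδ, hδρ⟩ : ∃ δ, (rootSystem H).IsLong δ ∧ (rootSystem H).pairingIn ℤ δ ρ = 1 := by
    by_contra! h
    exact hC (hρ.isHighest.exists_reindex_cartanMatrix_eq_C h)
  obtain ⟨j, hj, hj'⟩ := hρ.isHighest.exists_simple_repr_eq_one hδρ
  -- Here `α = -δ`, and `β` is the reflection of `δ` in `ρ`, namely `δ - ρ = -α - ρ`.
  refine ⟨j, (rootSystem H).reflectionPerm δ δ, (rootSystem H).reflectionPerm ρ δ, hj,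
    hδ.reflectionPerm δ, ?_, ?_⟩
  · rw [simpleCoeff, RootPairing.root_reflectionPerm, RootPairing.reflection_apply_self, map_neg,
      Finsupp.neg_apply, hj']
  · rw [RootPairing.root_reflectionPerm, RootPairing.root_reflectionPerm,
      RootPairing.reflection_apply_self, RootPairing.reflection_apply_root' ℤ, hδρ]
    module

end IsHighestRoot

end HighestRoot

end AdjointVariety

theorem mainTheorem10 {L : Type*} [LieRing L] [LieAlgebra ℂ L] [FiniteDimensional ℂ L]
    [LieAlgebra.IsSimple ℂ L] (H : LieSubalgebra ℂ L) [H.IsCartanSubalgebra]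
    (b : (rootSystem H).Base) (hA : ¬ AdjointVariety.IsTypeA b) (hC : ¬ AdjointVariety.IsTypeC b)
    (ρ : H.root) (hρ : AdjointVariety.IsHighestRoot b ρ) :
    ∃ B : Set (L × L), AdjointVariety.IsZariskiClosed B ∧
      (∀ z ∈ AdjointVariety.adjointVariety ρ, ∀ x ∈ z.submodule, x ≠ 0 →
        ∃ w : L, (x, w) ∈ AdjointVariety.contactDirections ρ ∧ (x, w) ∉ B) ∧
      (∀ x w : L, (x, w) ∈ AdjointVariety.contactDirections ρ → (x, w) ∉ B →
        ¬ AdjointVariety.TangentToLine (AdjointVariety.adjointVariety ρ) x w ∧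
        ¬ AdjointVariety.TangentToSmoothConic (AdjointVariety.adjointVariety ρ) x w) ∧
      (∃ (j₀ : b.support) (α β : H.root), (rootSystem H).pairing j₀ ρ ≠ 0 ∧
        AdjointVariety.IsLongRoot α ∧ AdjointVariety.simpleCoeff b j₀ α = -1 ∧
        (rootSystem H).root β = -(rootSystem H).root α - (rootSystem H).root ρ) ∧
      (∀ (j₀ : b.support) (α β : H.root), (rootSystem H).pairing j₀ ρ ≠ 0 →
        AdjointVariety.IsLongRoot α → AdjointVariety.simpleCoeff b j₀ α = -1 →
        (rootSystem H).root β = -(rootSystem H).root α - (rootSystem H).root ρ →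
        ∀ Eα ∈ rootSpace H α.1, ∀ Eβ ∈ rootSpace H β.1, ∀ Eρ ∈ rootSpace H ρ.1,
          Eα ≠ 0 → Eβ ≠ 0 → Eρ ≠ 0 →
          Eα + Eβ ∈ AdjointVariety.contactFiber ρ ∧
          (Eρ, ⁅Eα + Eβ, Eρ⁆) ∈ AdjointVariety.contactDirections ρ ∧
          (Eρ, ⁅Eα + Eβ, Eρ⁆) ∉ B) := by
  have hρ' : AdjointVariety.IsHighestRoot b ρ := hρ
  obtain ⟨j, α, β, hj, hα, hjα, hβ⟩ := hρ'.exists_long hC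
  refine ⟨{p : L × L | ∀ y : L, ⁅p.2, ⁅p.2, ⁅p.2, ⁅p.2, y⁆⁆⁆⁆ = 0},
    AdjointVariety.isZariskiClosed_ad_pow_four, ?_, ?_, ⟨j, α, β, hj, hα, hjα, hβ⟩, ?_⟩
  · rintro z ⟨g, hg, hz⟩ x hx hx0
    obtain ⟨A, hA, hA0⟩ := α.1.exists_ne_zero
    obtain ⟨B, hB, hB0⟩ := β.1.exists_ne_zero
    rw [hz] at hx
    obtain ⟨e, he, rfl⟩ := hx
    have he0 : e ≠ 0 := by
      rintro rfl
      simp at hx0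
    refine ⟨g ⁅A + B, e⁆, AdjointVariety.mem_contactDirections hg he
      (hρ'.add_mem_contactFiber hα hβ hA hB) he0
      (hρ'.lie_notMem_span hα hβ hA hB he hA0 hB0 he0), fun h ↦ ?_⟩
    obtain ⟨y, hy⟩ := hρ'.exists_lie_pow_four_ne_zero hα hβ hA hB he hA0 hB0 he0
    -- The condition `(ad w)⁴ = 0` is invariant under automorphisms, so a good direction at `o` is
    -- carried to every point of the orbit.
    refine hy (g.injective ?_)
    rw [map_zero]
    change g _ = 0
    simpa only [LieEquiv.map_lie] using h (g y)
  · intro x w hxw hB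
    exact ⟨fun h ↦ hB (hρ'.lie_pow_four_eq_zero hxw (.inl h)),
      fun h ↦ hB (hρ'.lie_pow_four_eq_zero hxw (.inr h))⟩
  · intro j α β _ hα _ hβ A hA B hB e he hA0 hB0 he0
    refine ⟨hρ'.add_mem_contactFiber hα hβ hA hB,
      AdjointVariety.mem_contactDirections (.refl) he (hρ'.add_mem_contactFiber hα hβ hA hB) he0
        (hρ'.lie_notMem_span hα hβ hA hB he hA0 hB0 he0), fun h ↦ ?_⟩
    obtain ⟨y, hy⟩ := hρ'.exists_lie_pow_four_ne_zero hα hβ hA hB he hA0 hB0 he0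
    exact hy (h y)
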